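/- **Theorem (Boundedness I).** Let $K$ be a smooth function with $K(z)=1$ for $0\le z\le 1$ and $K(z)=0$ for $z\ge 4$, and for real $B$ put $\Delta_\Lambda(k)=K(k^2/\Lambda^2)/(k^2+B)$, $k\in\mathbb{R}^4$. Let $0<\Lambda_R\le\Lambda_0$ and let $A,B$ be real constants with $|A|\le\Lambda_R^3$, $|B|\le\Lambda_R^2$ (so $|\Lambda^{-3}A|\le1$, $|\Lambda^{-2}B|\le1$ for $\Lambda\ge\Lambda_R$). Consider scalar $\phi^3+\phi^4$ theory in four Euclidean dimensions in perturbation theory in the renormalized couplings $\rho_4^R,\rho_5^R$: the vertex functions are formal series $L_n=\sum_{r_1,r_2\ge0}(\rho_4^R)^{r_1}(\rho_5^R)^{r_2}L_n^{(r_1,r_2)}$, $n\ge1$. The coefficients $L_n^{(r_1,r_2)}(k_1,\dots,k_n,\Lambda)$ are real functions defined for $k_i\in\mathbb{R}^4$ with $\sum_i k_i=0$ and $\Lambda_R\le\Lambda\le\Lambda_0$; they are smooth in the momenta, with momentum derivatives jointly continuous in $(k,\Lambda)$, symmetric under permutations of the $k_i$, and $O(4)$-invariant. Moreover $L_n^{(0,0)}=0$,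 and at each order the effective potential is a polynomial in the field: $L_n^{(r_1,r_2)}=0$ for $n>N(r_1,r_2)$, with $N$ independent of the scales (usually $N=2(r_1+r_2)+2$). They satisfy, order by order in $\rho_4^R,\rho_5^R$, the Polchinski equation $$\frac{d}{d\Lambda}L_n(k_1,\dots,k_n,\Lambda)=-\frac12\sum_{I\subseteq\{1,\dots,n\}}\frac{d\Delta_\Lambda}{d\Lambda}(k_I)\,L_{|I|+1}\big((k_i)_{i\in I},-k_I,\Lambda\big)\,L_{n-|I|+1}\big((k_i)_{i\notin I},k_I,\Lambda\big)$$ $$\qquad-\frac12\int\frac{d^4q}{(2\pi)^4}\,L_{n+2}(k_1,\dots,k_n,q,-q,\Lambda)\,\frac{d\Delta_\Lambda}{d\Lambda}(q)-\frac12A\,L_{n+1}(k_1,\dots,k_n,0,\Lambda)\,\frac{d\Delta_\Lambda}{d\Lambda}(0),\qquad k_I:=\sum_{i\in I}k_i .$$ Let $\partial^p=\partial^{\mu_1}_{i_1,j_1}\cdots\partial^{\mu_p}_{i_p,j_p}$ with $\partial^\mu_{i,j}=\partial/\partial k_i^\mu-\partial/\partial k_j^\mu$. At $\Lambda=\Lambda_R$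 impose the renormalization conditions $$L_1(0)=0,\quad L_2(0,0)=0,\quad \partial^\mu_{1,2}\partial^\nu_{1,2}L_2(0,0)=0,\quad L_3(0,0,0)=\rho_4^R,\quad L_4(0,0,0,0)=\rho_5^R .$$ Define $A_n^{(r_1,r_2)}=\Lambda^{n+r_1-4}L_n^{(r_1,r_2)}$ and, at scale $\Lambda$, $\|f\|=\max\{|f(k_1,\dots,k_n)|:\ \sum_ik_i=0,\ k_i^2\le4\Lambda^2\}$. Below, $Pln(z)$ stands for some polynomial in $\ln z$ with nonnegative coefficients, possibly different at each occurrence and depending on $n,p,r_1,r_2$, but not on $\Lambda,\Lambda_0,\Lambda_R,A,B$ nor on the indices $i_a,j_a,\mu_a$ of $\partial^p$. Fix $r_1,r_2$ and assume that at $\Lambda_0$, for all orders $s_1\le r_1$, $s_2\le r_2$, all $n\ge1$, $p\ge0$ with $n+p\ge5$, and all $\partial^p$, $$\|\partial^pA_n^{(s_1,s_2)}(\Lambda_0)\|\le\Lambda_0^{-p}\Big(\frac{\Lambda_0}{\Lambda_R}\Big)^{s_1}Pln\Big(\frac{\Lambda_0}{\Lambda_R}\Big).$$ Then for all $n\ge1$,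 $p\ge0$, all $\partial^p$ and all $\Lambda_R\le\Lambda\le\Lambda_0$, $$\|\partial^pA_n^{(r_1,r_2)}(\Lambda)\|\le\Lambda^{-p}\Big(\frac{\Lambda}{\Lambda_R}\Big)^{r_1}\Big(Pln\Big(\frac{\Lambda}{\Lambda_R}\Big)+\frac{\Lambda}{\Lambda_0}\,Pln\Big(\frac{\Lambda_0}{\Lambda_R}\Big)\Big),$$ where the polynomials in the conclusion depend only on $n,p,r_1,r_2$, the cutoff function $K$, the degree bound $N$ and the polynomials in the assumption. -/

import Mathlib

open scoped ContDiff

noncomputable section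

namespace ScalarFlow

/-- Momenta in four-dimensional Euclidean space. -/
abbrev Momentum : Type := EuclideanSpace ℝ (Fin 4)

/-- Configurations `(k₁, …, kₙ)` of `n` momenta with `k₁ + ⋯ + kₙ = 0`, the domain of the
`n`-point vertex functions. -/
def MomentumSpace (n : ℕ) : Submodule ℝ (Fin n → Momentum) where
  carrier := {k | ∑ i, k i = 0}
  add_mem' := by
    intro a b ha hb
    simp only [Set.mem_ofPred_eq, Pi.add_apply, Finset.sum_add_distrib] at *
    rw [ha, hb, add_zero]
  zero_mem' := by simp
  smul_mem' := by
    intro c a ha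
    simp only [Set.mem_ofPred_eq, Pi.smul_apply, ← Finset.smul_sum] at *
    rw [ha, smul_zero]

theorem mem_momentumSpace {n : ℕ} {k : Fin n → Momentum} :
    k ∈ MomentumSpace n ↔ ∑ i, k i = 0 := Iff.rfl

/-! ### The cutoff and the regularized propagator -/

/-- A smooth cutoff function: `1` on `[0, 1]` and `0` on `[4, ∞)`. -/
structure IsCutoff (K : ℝ → ℝ) : Prop where
  smooth : ContDiff ℝ ∞ K
  eq_one : ∀ z, 0 ≤ z → z ≤ 1 → K z = 1
  eq_zero : ∀ z, 4 ≤ z → K z = 0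

/-- The regularized propagator `K(k² / Λ²) / (k² + B)`. -/
def propagator (K : ℝ → ℝ) (B Λ : ℝ) (k : Momentum) : ℝ :=
  K (‖k‖ ^ 2 / Λ ^ 2) / (‖k‖ ^ 2 + B)

/-- The scale derivative of the propagator at fixed momentum. Its numerator vanishes for
`k² ≤ Λ²`, so that the zero of `k² + B` there is harmless when `|B| ≤ Λ²`. -/
def propagatorDeriv (K : ℝ → ℝ) (B Λ : ℝ) (k : Momentum) : ℝ :=
  deriv (fun s => propagator K B s k) Λ

/-! ### Momentum arguments of the vertex functions in the flow equation -/

/-- The momenta `(k_I, -∑_{i ∈ I} k_i)`. -/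
def branchMomenta {n : ℕ} (k : MomentumSpace n) (I : Finset (Fin n)) :
    MomentumSpace (I.card + 1) :=
  ⟨Fin.snoc (α := fun _ => Momentum) (fun a => k.1 (I.orderEmbOfFin rfl a)) (-∑ i ∈ I, k.1 i), by
    rw [mem_momentumSpace, Fin.sum_univ_castSucc]
    simp only [Fin.snoc_castSucc, Fin.snoc_last]
    have h : ∑ a, k.1 (I.orderEmbOfFin rfl a) = ∑ i ∈ I, k.1 i := by
      conv_rhs => rw [← Finset.map_orderEmbOfFin_univ I rfl]
      rw [Finset.sum_map]
      rfl
    rw [h, add_neg_cancel]⟩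

/-- The momenta `(k₁, …, kₙ, q, -q)`. -/
def loopMomenta {n : ℕ} (k : MomentumSpace n) (q : Momentum) : MomentumSpace (n + 2) :=
  ⟨Fin.snoc (α := fun _ => Momentum) (Fin.snoc (α := fun _ => Momentum) k.1 q) (-q), by
    have hk := mem_momentumSpace.1 k.2
    rw [mem_momentumSpace, Fin.sum_univ_castSucc, Fin.sum_univ_castSucc]
    simp only [Fin.snoc_castSucc, Fin.snoc_last]
    rw [hk, zero_add, add_neg_cancel]⟩

/-- The momenta `(k₁, …, kₙ, 0)`. -/
def tadpoleMomenta {n : ℕ} (k : MomentumSpace n) : MomentumSpace (n + 1) :=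
  ⟨Fin.snoc (α := fun _ => Momentum) k.1 0, by
    have hk := mem_momentumSpace.1 k.2
    rw [mem_momentumSpace, Fin.sum_univ_castSucc]
    simp only [Fin.snoc_castSucc, Fin.snoc_last]
    rw [hk, add_zero]⟩

/-- The momenta `(k_{π 1}, …, k_{π n})`. -/
def permuteMomenta {n : ℕ} (π : Equiv.Perm (Fin n)) (k : MomentumSpace n) : MomentumSpace n :=
  ⟨fun i => k.1 (π i), by
    rw [mem_momentumSpace, Equiv.sum_comp π k.1]
    exact k.2⟩

/-- The momenta `(R k₁, …, R kₙ)`. -/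
def rotateMomenta {n : ℕ} (R : Momentum ≃ₗᵢ[ℝ] Momentum) (k : MomentumSpace n) :
    MomentumSpace n :=
  ⟨fun i => R (k.1 i), by
    have hk := mem_momentumSpace.1 k.2
    rw [mem_momentumSpace, ← map_sum, hk, map_zero]⟩

/-! ### The flow equation in perturbation theory -/

/-- Perturbative coefficients `L_n^{(r₁,r₂)}(k₁, …, kₙ, Λ)` of the vertex functions in
`L_n = ∑ ρ₄^{r₁} ρ₅^{r₂} L_n^{(r₁,r₂)}`, as `L r₁ r₂ n Λ k`. Only `n ≥ 1` is used. -/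
abbrev VertexCoefficients : Type := ℕ → ℕ → (n : ℕ) → ℝ → MomentumSpace n → ℝ

/-- The right-hand side, at order `(r₁, r₂)`, of the Polchinski equation for the `n`-point vertex
function. The sum over the subsets `I` of the external legs is the sum over `l = |I| + 1` and over
the ways to distribute the legs over the two factors. -/
def flowRHS (K : ℝ → ℝ) (A B : ℝ) (L : VertexCoefficients) (r₁ r₂ n : ℕ) (Λ : ℝ)
    (k : MomentumSpace n) : ℝ :=
  - (1 / 2) * (∑ s ∈ Finset.HasAntidiagonal.antidiagonal r₁, ∑ t ∈ Finset.HasAntidiagonal.antidiagonal r₂,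
      ∑ I : Finset (Fin n), propagatorDeriv K B Λ (∑ i ∈ I, k.1 i)
        * L s.1 t.1 (I.card + 1) Λ (branchMomenta k I)
        * L s.2 t.2 (Iᶜ.card + 1) Λ (branchMomenta k Iᶜ))
  - (1 / 2) * (1 / (2 * Real.pi) ^ 4 *
      ∫ q : Momentum, L r₁ r₂ (n + 2) Λ (loopMomenta k q) * propagatorDeriv K B Λ q)
  - (1 / 2) * A * L r₁ r₂ (n + 1) Λ (tadpoleMomenta k) * propagatorDeriv K B Λ 0

/-- `L` is a perturbative solution of the Polchinski equation on the scales `[Λ_R, Λ₀]`, with field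
degree at most `N r₁ r₂` at order `(r₁, r₂)`. -/
structure IsPerturbativeSolution (K : ℝ → ℝ) (A B : ℝ) (N : ℕ → ℕ → ℕ) (ΛR Λ0 : ℝ)
    (L : VertexCoefficients) : Prop where
  /-- The vertex functions are smooth in the momenta. -/
  smooth : ∀ r₁ r₂ n, 1 ≤ n → ∀ Λ ∈ Set.Icc ΛR Λ0, ContDiff ℝ ∞ (L r₁ r₂ n Λ)
  /-- Their momentum derivatives are jointly continuous in the scale and the momenta. -/
  continuous : ∀ r₁ r₂ n, 1 ≤ n → ∀ p : ℕ,
    ContinuousOn (fun x : ℝ × MomentumSpace n => iteratedFDeriv ℝ p (L r₁ r₂ n x.1) x.2)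
      (Set.Icc ΛR Λ0 ×ˢ Set.univ)
  /-- Bose symmetry. -/
  symmetric : ∀ r₁ r₂ n, 1 ≤ n → ∀ Λ ∈ Set.Icc ΛR Λ0, ∀ (π : Equiv.Perm (Fin n)) k,
    L r₁ r₂ n Λ (permuteMomenta π k) = L r₁ r₂ n Λ k
  /-- Invariance under the orthogonal group. -/
  orthogonal : ∀ r₁ r₂ n, 1 ≤ n → ∀ Λ ∈ Set.Icc ΛR Λ0, ∀ (R : Momentum ≃ₗᵢ[ℝ] Momentum) k,
    L r₁ r₂ n Λ (rotateMomenta R k) = L r₁ r₂ n Λ k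
  /-- The vertex functions vanish to zeroth order. -/
  zeroth_order : ∀ n, 1 ≤ n → ∀ Λ ∈ Set.Icc ΛR Λ0, ∀ k, L 0 0 n Λ k = 0
  /-- At each order the effective potential is a polynomial in the field. -/
  degree : ∀ r₁ r₂ n, 1 ≤ n → N r₁ r₂ < n → ∀ Λ ∈ Set.Icc ΛR Λ0, ∀ k, L r₁ r₂ n Λ k = 0
  /-- The Polchinski equation. -/
  flow : ∀ r₁ r₂ n, 1 ≤ n → ∀ Λ ∈ Set.Icc ΛR Λ0, ∀ k,
    HasDerivWithinAt (fun s => L r₁ r₂ n s k) (flowRHS K A B L r₁ r₂ n Λ k)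
      (Set.Icc ΛR Λ0) Λ

/-! ### Momentum derivatives, norms, renormalization conditions -/

/-- The direction in which `∂^μ_{i,j} = ∂/∂k_i^μ - ∂/∂k_j^μ` differentiates. -/
def direction {n : ℕ} (i j : Fin n) (μ : Fin 4) : MomentumSpace n :=
  ⟨Pi.single i (EuclideanSpace.single μ 1) - Pi.single j (EuclideanSpace.single μ 1), by
    rw [mem_momentumSpace]
    simp [Finset.sum_sub_distrib, Finset.sum_pi_single']⟩

/-- `∂^p f = ∂^{μ₁}_{i₁,j₁} ⋯ ∂^{μ_p}_{i_p,j_p} f`. -/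
def momentumDeriv {n p : ℕ} (i j : Fin p → Fin n) (μ : Fin p → Fin 4)
    (f : MomentumSpace n → ℝ) (k : MomentumSpace n) : ℝ :=
  iteratedFDeriv ℝ p f k (fun a => direction (i a) (j a) (μ a))

/-- The configurations with `k_i² ≤ 4 Λ²` for every `i`. -/
def momentumRegion (n : ℕ) (Λ : ℝ) : Set (MomentumSpace n) :=
  {k | ∀ i, ‖k.1 i‖ ^ 2 ≤ 4 * Λ ^ 2}

/-- `‖f‖ = max |f(k₁, …, kₙ)|` over `k_i² ≤ 4 Λ²`. -/
def vertexNorm {n : ℕ} (Λ : ℝ) (f : MomentumSpace n → ℝ) : ℝ :=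
  sSup ((fun k => |f k|) '' momentumRegion n Λ)

/-- For continuous functions the norm is a maximum. -/
theorem isGreatest_vertexNorm {n : ℕ} (Λ : ℝ) {f : MomentumSpace n → ℝ} (hf : Continuous f) :
    IsGreatest ((fun k => |f k|) '' momentumRegion n Λ) (vertexNorm Λ f) := by
  have hclosed : IsClosed (momentumRegion n Λ) := by
    have h : momentumRegion n Λ = ⋂ i, {k : MomentumSpace n | ‖k.1 i‖ ^ 2 ≤ 4 * Λ ^ 2} := by
      ext k
      simp [momentumRegion]
    rw [h]
    exact isClosed_iInter fun i => isClosed_le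
      (((continuous_apply i).comp continuous_subtype_val).norm.pow 2) continuous_const
  have hbdd : Bornology.IsBounded (momentumRegion n Λ) := by
    refine (Metric.isBounded_closedBall (x := (0 : MomentumSpace n)) (r := 2 * |Λ|)).subset ?_
    intro k hk
    rw [mem_closedBall_zero_iff]
    change ‖k.1‖ ≤ 2 * |Λ|
    refine (pi_norm_le_iff_of_nonneg (by positivity)).2 fun i => ?_
    refine abs_le_of_sq_le_sq' (a := ‖k.1 i‖) ?_ (by positivity) |>.2
    have := hk i
    nlinarith [sq_abs Λ]
  have hcpt : IsCompact (momentumRegion n Λ) := Metric.isCompact_of_isClosed_isBounded hclosed hbdd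
  have hne : (momentumRegion n Λ).Nonempty := ⟨0, fun i => by simp; positivity⟩
  exact (hcpt.image (by fun_prop)).isGreatest_sSup (hne.image _)

/-- The dimensionless coefficients `A_n^{(r₁,r₂)} = Λ^{n + r₁ - 4} L_n^{(r₁,r₂)}`. -/
def dimensionless (L : VertexCoefficients) (r₁ r₂ n : ℕ) (Λ : ℝ) (k : MomentumSpace n) : ℝ :=
  Λ ^ ((n : ℤ) + r₁ - 4) * L r₁ r₂ n Λ k

/-- The renormalization conditions `ρ₁ = ρ₂ = ρ₃ = 0`, `ρ₄ = ρ₄^R`, `ρ₅ = ρ₅^R` at the scale `Λ_R`,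
order by order in `ρ₄^R` and `ρ₅^R`, for the running couplings `ρ₁ = L₁(0)`, `ρ₂ = L₂(0, 0)`,
`ρ₃ δ^{μν} = ∂^μ_{1,2} ∂^ν_{1,2} L₂(0, 0)`, `ρ₄ = L₃(0, 0, 0)` and `ρ₅ = L₄(0, 0, 0, 0)`. -/
structure RenormalizationConditions (ΛR : ℝ) (L : VertexCoefficients) : Prop where
  rho_one : ∀ r₁ r₂, L r₁ r₂ 1 ΛR 0 = 0
  rho_two : ∀ r₁ r₂, L r₁ r₂ 2 ΛR 0 = 0
  rho_three : ∀ r₁ r₂ (μ ν : Fin 4),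
    momentumDeriv ![0, 0] ![1, 1] ![μ, ν] (L r₁ r₂ 2 ΛR) 0 = 0
  rho_four : ∀ r₁ r₂, L r₁ r₂ 3 ΛR 0 = if r₁ = 1 ∧ r₂ = 0 then 1 else 0
  rho_five : ∀ r₁ r₂, L r₁ r₂ 4 ΛR 0 = if r₁ = 0 ∧ r₂ = 1 then 1 else 0

end ScalarFlow

end

/-! The proof is Polchinski's power counting. In terms of the undivided coefficients the claim
reads: order-`p` derivatives of $L_n^{(s,t)}$ are at most $\Lambda^{4-n-p}\Lambda_R^{-s}$ times
$P(\ln(\Lambda/\Lambda_R))+(\Lambda/\Lambda_0)\,Q(\ln(\Lambda_0/\Lambda_R))$ on $k_i^2\le4\Lambda^2$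
(`HasVertexBound`). Operator norms of the full derivatives replace the individual $\partial^p$; this
loses only constants, since the directions of $\partial^\mu_{i,j}$ span the space of momenta.

The flow equation is triangular for a double induction, upwards in $r_1+r_2$ and, at fixed order,
downwards in $n$ (`hasVertexBound`). As $L^{(0,0)}=0$, both factors of a tree term have strictly
lower order. The loop term has the same order but two more legs, and the vertices vanish for $n>N$.
The $A$ term vanishes because the cutoff is constant near zero momentum. The derivatives of
$d\Delta_\Lambda/d\Lambda$ scale like $\Lambda^{-3-p}$ uniformly in $B$
(`exists_propagatorDeriv_bound`), and the loop integral adds a volume of order $\Lambda^4$. Hence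
the right-hand side is of size $\Lambda^{3-n-p}\Lambda_R^{-s}$ times logarithms
(`isFlowTerm_flowRHS`).

The integration over the scale depends on the sign of $4-n-p$. For $n+p\ge5$ the integral from
$\Lambda$ to $\Lambda_0$ is dominated by its lower end, and the data at $\Lambda_0$ enter with a
gain $\Lambda/\Lambda_0$ (`hasVertexBound_irrelevant`). For $n+p\le4$ the flow is integrated upwards
from $\Lambda_R$ at zero momenta only, where the renormalization conditions fix the even derivatives
(`hasVertexBoundAtZero_relevant`) and reflection symmetry kills the odd ones. The mean value
inequality then extends the bound to nonzero momenta, using derivatives of order $p+1$ that are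
already controlled (`hasVertexBound_of_atZero`), so $p$ is treated in descending order.

All constants are uniform because each bound is one existential statement placed before the
quantifier over all solutions `FlowData`. Differentiation of the loop and scale integrals is handled
by the calculus of `ContFamily`. -/

namespace ScalarFlow

open MeasureTheory

/-! ### Families of smooth functions depending continuously on a parameter -/

/-- A family of functions `f x`, `x ∈ X`, of class `C^p`, all of whose derivatives of order at
most `p` are jointly continuous. -/
def ContFamily {X : Type} [TopologicalSpace X] {E : Type} [NormedAddCommGroup E]
    [NormedSpace ℝ E] :
    (p : ℕ) → {F : Type} → [NormedAddCommGroup F] → [NormedSpace ℝ F] → (X → E → F) → Prop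
  | 0, _, _, _, f => Continuous (Function.uncurry f)
  | p + 1, _, _, _, f => Continuous (Function.uncurry f) ∧ (∀ x, Differentiable ℝ (f x)) ∧
      ContFamily p (fun x => fderiv ℝ (f x))

section

variable {X : Type} [TopologicalSpace X] {E : Type} [NormedAddCommGroup E] [NormedSpace ℝ E]
  {F : Type} [NormedAddCommGroup F] [NormedSpace ℝ F]

theorem ContFamily.cont {p : ℕ} {f : X → E → F} (hf : ContFamily p f) :
    Continuous (Function.uncurry f) := by
  cases p with
  | zero => exact hf
  | succ p => exact hf.1

theorem ContFamily.of_succ {p : ℕ} : ∀ {F : Type} [NormedAddCommGroup F] [NormedSpace ℝ F]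
    {f : X → E → F}, ContFamily (p + 1) f → ContFamily p f := by
  induction p with
  | zero => intro F _ _ f hf; exact hf.1
  | succ p ih => intro F _ _ f hf; exact ⟨hf.1, hf.2.1, ih hf.2.2⟩

theorem ContFamily.add {p : ℕ} : ∀ {F : Type} [NormedAddCommGroup F] [NormedSpace ℝ F]
    {f g : X → E → F}, ContFamily p f → ContFamily p g →
    ContFamily p (fun x e => f x e + g x e) := by
  induction p with
  | zero => intro F _ _ f g hf hg; exact Continuous.add hf hg
  | succ p ih =>
    intro F _ _ f g hf hg
    refine ⟨hf.1.add hg.1, fun x => (hf.2.1 x).add (hg.2.1 x), ?_⟩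
    have := ih hf.2.2 hg.2.2
    refine (congrArg _ ?_).mp this
    funext x e
    exact (fderiv_add (hf.2.1 x e) (hg.2.1 x e)).symm

theorem contFamily_zero {p : ℕ} : ∀ {F : Type} [NormedAddCommGroup F] [NormedSpace ℝ F],
    ContFamily p (fun (_ : X) (_ : E) => (0 : F)) := by
  induction p with
  | zero => intro F _ _; exact continuous_const
  | succ p ih =>
    intro F _ _
    refine ⟨continuous_const, fun x => differentiable_const _, ?_⟩
    refine (congrArg _ ?_).mp ih
    funext x e
    simp

theorem ContFamily.sum {p : ℕ} {ι : Type} (s : Finset ι) {f : ι → X → E → F}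
    (h : ∀ i ∈ s, ContFamily p (f i)) : ContFamily p (fun x e => ∑ i ∈ s, f i x e) := by
  classical
  induction s using Finset.induction_on with
  | empty => simpa using contFamily_zero
  | insert a s ha ih =>
    simp only [Finset.sum_insert ha]
    exact (h a (by simp)).add (ih fun i hi => h i (by simp [hi]))

theorem ContFamily.clm_comp {p : ℕ} : ∀ {F G : Type} [NormedAddCommGroup F] [NormedSpace ℝ F]
    [NormedAddCommGroup G] [NormedSpace ℝ G] (T : F →L[ℝ] G) {f : X → E → F},
    ContFamily p f → ContFamily p (fun x e => T (f x e)) := by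
  induction p with
  | zero => intro F G _ _ _ _ T f hf; exact T.continuous.comp hf
  | succ p ih =>
    intro F G _ _ _ _ T f hf
    refine ⟨T.continuous.comp hf.1, fun x => T.differentiable.comp (hf.2.1 x), ?_⟩
    have := ih (ContinuousLinearMap.compL ℝ E F G T) hf.2.2
    refine (congrArg _ ?_).mp this
    funext x e
    exact ((T.hasFDerivAt.comp e (hf.2.1 x e).hasFDerivAt).fderiv).symm

theorem ContFamily.bilin {p : ℕ} : ∀ {F G H : Type} [NormedAddCommGroup F] [NormedSpace ℝ F]
    [NormedAddCommGroup G] [NormedSpace ℝ G] [NormedAddCommGroup H] [NormedSpace ℝ H]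
    (B : F →L[ℝ] G →L[ℝ] H) {f : X → E → F} {g : X → E → G},
    ContFamily p f → ContFamily p g → ContFamily p (fun x e => B (f x e) (g x e)) := by
  induction p with
  | zero =>
    intro F G H _ _ _ _ _ _ B f g hf hg
    exact (B.continuous.comp hf).clm_apply hg
  | succ p ih =>
    intro F G H _ _ _ _ _ _ B f g hf hg
    refine ⟨(B.continuous.comp hf.1).clm_apply hg.1, fun x e =>
      (B.hasFDerivAt_of_bilinear (hf.2.1 x e).hasFDerivAt
        (hg.2.1 x e).hasFDerivAt).differentiableAt, ?_⟩
    have h1 := ih (B.precompR E) hf.of_succ hg.2.2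
    have h2 := ih (B.precompL E) hf.2.2 hg.of_succ
    refine (congrArg _ ?_).mp (h1.add h2)
    funext x e
    exact (B.fderiv_of_bilinear (hf.2.1 x e) (hg.2.1 x e)).symm

theorem ContFamily.mul {p : ℕ} {f g : X → E → ℝ} (hf : ContFamily p f) (hg : ContFamily p g) :
    ContFamily p (fun x e => f x e * g x e) :=
  hf.bilin (ContinuousLinearMap.mul ℝ ℝ) hg

theorem ContFamily.const_mul {p : ℕ} {f : X → E → ℝ} (c : ℝ) (hf : ContFamily p f) :
    ContFamily p (fun x e => c * f x e) :=
  hf.clm_comp (ContinuousLinearMap.mul ℝ ℝ c)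

/-- Reparametrization of the family and affine substitutions. -/
theorem ContFamily.comp_affine {p : ℕ} {X' E' : Type} [TopologicalSpace X']
    [NormedAddCommGroup E'] [NormedSpace ℝ E'] {φ : X' → X} (hφ : Continuous φ) (T : E' →L[ℝ] E)
    {c : X' → E} (hc : Continuous c) :
    ∀ {F : Type} [NormedAddCommGroup F] [NormedSpace ℝ F] {f : X → E → F},
    ContFamily p f → ContFamily p (fun x e => f (φ x) (T e + c x)) := by
  induction p with
  | zero =>
    intro F _ _ f hf
    exact Continuous.comp hf (by fun_prop : Continuous fun y : X' × E' => (φ y.1, T y.2 + c y.1))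
  | succ p ih =>
    intro F _ _ f hf
    have hd : ∀ x e, HasFDerivAt (fun e => f (φ x) (T e + c x))
        ((fderiv ℝ (f (φ x)) (T e + c x)).comp T) e := fun x e =>
      ((hf.2.1 (φ x) _).hasFDerivAt).comp e ((T.hasFDerivAt).add_const (c x))
    refine ⟨hf.1.comp (by fun_prop : Continuous fun y : X' × E' => (φ y.1, T y.2 + c y.1)),
      fun x e => (hd x e).differentiableAt, ?_⟩
    have := (ih hf.2.2).clm_comp ((ContinuousLinearMap.compL ℝ E' E F).flip T)
    refine (congrArg _ ?_).mp this
    funext x e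
    exact (hd x e).fderiv.symm

theorem ContFamily.comp_param {p : ℕ} {X' : Type} [TopologicalSpace X'] {φ : X' → X}
    (hφ : Continuous φ) {f : X → E → F} (hf : ContFamily p f) :
    ContFamily p (fun x => f (φ x)) := by
  simpa using hf.comp_affine hφ (ContinuousLinearMap.id ℝ E) (c := fun _ => 0) continuous_const

/-- The recursive form suits inductions on `p` with varying target space, while the joint continuity
of the vertex functions is given in terms of iterated derivatives. Currying isometries pass between
the two. -/
theorem contFamily_iff {p : ℕ} : ∀ {F : Type} [NormedAddCommGroup F] [NormedSpace ℝ F]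
    {f : X → E → F}, ContFamily p f ↔ (∀ x, ContDiff ℝ p (f x)) ∧
      ∀ j ≤ p, Continuous fun y : X × E => iteratedFDeriv ℝ j (f y.1) y.2 := by
  have h0 : ∀ {F : Type} [NormedAddCommGroup F] [NormedSpace ℝ F] {f : X → E → F},
      (Continuous fun y : X × E => iteratedFDeriv ℝ 0 (f y.1) y.2) ↔
        Continuous (Function.uncurry f) := by
    intro F _ _ f
    simp only [iteratedFDeriv_zero_eq_comp, Function.comp_def]
    exact (continuousMultilinearCurryFin0 ℝ E F).symm.toHomeomorph.comp_continuous_iff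
  have h1 : ∀ {F : Type} [NormedAddCommGroup F] [NormedSpace ℝ F] {f : X → E → F} (j : ℕ),
      (Continuous fun y : X × E => iteratedFDeriv ℝ (j + 1) (f y.1) y.2) ↔
        Continuous fun y : X × E => iteratedFDeriv ℝ j (fderiv ℝ (f y.1)) y.2 := by
    intro F _ _ f j
    simp only [iteratedFDeriv_succ_eq_comp_right, Function.comp_def]
    exact (continuousMultilinearCurryRightEquiv' ℝ j E F).symm.toHomeomorph.comp_continuous_iff
  induction p with
  | zero =>
    intro F _ _ f
    constructor
    · intro h
      refine ⟨fun x => ?_, fun j hj => ?_⟩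
      · simp only [Nat.cast_zero, contDiff_zero]
        exact h.cont.comp (by fun_prop : Continuous fun e : E => (x, e))
      · obtain rfl : j = 0 := by omega
        exact h0.2 h
    · intro h
      exact h0.1 (h.2 0 le_rfl)
  | succ p ih =>
    intro F _ _ f
    constructor
    · rintro ⟨hc, hd, hf⟩
      rw [ih] at hf
      refine ⟨fun x => ?_, fun j hj => ?_⟩
      · rw [Nat.cast_succ, contDiff_succ_iff_fderiv]
        exact ⟨hd x, by simp, hf.1 x⟩
      · cases j with
        | zero => exact h0.2 hc
        | succ j => exact (h1 j).2 (hf.2 j (by omega))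
    · rintro ⟨hs, hc⟩
      refine ⟨h0.1 (hc 0 (by omega)), fun x => (hs x).differentiable (by simp), ih.2 ⟨fun x => ?_, ?_⟩⟩
      · have := hs x
        rw [Nat.cast_succ, contDiff_succ_iff_fderiv] at this
        exact this.2.2
      · intro j hj
        exact (h1 j).1 (hc (j + 1) (by omega))

/-- A jointly smooth function defines a family depending continuously on its first variable. -/
theorem contFamily_of_contDiffOn {p : ℕ} {V : Type} [NormedAddCommGroup V] [NormedSpace ℝ V]
    {U S : Set V} (hU : IsOpen U) (hS : S ⊆ U) : ∀ {F : Type} [NormedAddCommGroup F]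
    [NormedSpace ℝ F] {g : V × E → F}, ContDiffOn ℝ ∞ g (U ×ˢ Set.univ) →
    ContFamily p (fun (x : S) e => g (x.1, e)) := by
  have hUo : IsOpen (U ×ˢ (Set.univ : Set E)) := hU.prod isOpen_univ
  have hc : ∀ {F : Type} [NormedAddCommGroup F] [NormedSpace ℝ F] {g : V × E → F},
      ContDiffOn ℝ ∞ g (U ×ˢ Set.univ) →
      Continuous (Function.uncurry fun (x : S) e => g (x.1, e)) := fun hg =>
    hg.continuousOn.comp_continuous
      (by fun_prop : Continuous fun y : S × E => ((y.1 : V), y.2)) fun y => ⟨hS y.1.2, trivial⟩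
  induction p with
  | zero => intro F _ _ g hg; exact hc hg
  | succ p ih =>
    intro F _ _ g hg
    have hd : ∀ (x : S) (e : E), HasFDerivAt (fun e => g (x.1, e))
        ((fderiv ℝ g (x.1, e)).comp (ContinuousLinearMap.inr ℝ V E)) e := by
      intro x e
      have h1 : DifferentiableAt ℝ g (x.1, e) :=
        (hg.differentiableOn (by simp)).differentiableAt (hUo.mem_nhds ⟨hS x.2, trivial⟩)
      exact h1.hasFDerivAt.comp e (hasFDerivAt_prodMk_right x.1 e)
    refine ⟨hc hg, fun x e => (hd x e).differentiableAt, ?_⟩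
    have h2 : ContDiffOn ℝ ∞ (fderiv ℝ g) (U ×ˢ Set.univ) := hg.fderiv_of_isOpen hUo (by simp)
    have := (ih h2).clm_comp ((ContinuousLinearMap.compL ℝ E (V × E) F).flip
      (ContinuousLinearMap.inr ℝ V E))
    refine (congrArg _ ?_).mp this
    funext x e
    exact (hd x e).fderiv.symm

end

/-! ### Integrals of smooth families over a compact set -/

section

variable {X : Type} [TopologicalSpace X]
  {Y : Type} [TopologicalSpace Y] [MeasurableSpace Y] [OpensMeasurableSpace Y]
  [SecondCountableTopology Y] [T2Space Y] {μ : Measure Y} [IsLocallyFiniteMeasure μ]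
  {C : Set Y}
  {E : Type} [NormedAddCommGroup E] [NormedSpace ℝ E] [FiniteDimensional ℝ E]

/-- Joint continuity bounds the derivative on the compact product of `C` with a closed unit ball
around `e`, so a constant dominates and dominated differentiation applies. -/
theorem ContFamily.hasFDerivAt_integral (hC : IsCompact C) {F : Type} [NormedAddCommGroup F]
    [NormedSpace ℝ F] {f : X × Y → E → F} (hf : ContFamily 1 f) (x : X) (e : E) :
    HasFDerivAt (fun e => ∫ y in C, f (x, y) e ∂μ) (∫ y in C, fderiv ℝ (f (x, y)) e ∂μ) e := by
  have : ProperSpace E := FiniteDimensional.proper ℝ E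
  have hc : Continuous fun z : Y × E => fderiv ℝ (f (x, z.1)) z.2 :=
    Continuous.comp hf.2.2 (by fun_prop : Continuous fun z : Y × E => ((x, z.1), z.2))
  have hc0 : Continuous fun z : Y × E => f (x, z.1) z.2 :=
    Continuous.comp hf.1 (by fun_prop : Continuous fun z : Y × E => ((x, z.1), z.2))
  obtain ⟨M, hM⟩ := ((hC.prod (isCompact_closedBall e 1)).bddAbove_image hc.norm.continuousOn)
  have hMb : ∀ y ∈ C, ∀ z ∈ Metric.closedBall e 1, ‖fderiv ℝ (f (x, y)) z‖ ≤ M := by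
    intro y hy z hz
    exact hM ⟨(y, z), ⟨hy, hz⟩, rfl⟩
  refine hasFDerivAt_integral_of_dominated_of_fderiv_le (𝕜 := ℝ) (bound := fun _ => M)
    (F := fun e y => f (x, y) e) (F' := fun e y => fderiv ℝ (f (x, y)) e)
    (Metric.closedBall_mem_nhds e one_pos) ?_ ?_ ?_ ?_ ?_ ?_
  · filter_upwards with z
    exact (hc0.comp (by fun_prop : Continuous fun y : Y => (y, z))).aestronglyMeasurable
  · exact ((hc0.comp (by fun_prop : Continuous fun y : Y => (y, e))).continuousOn).integrableOn_compact hC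
  · exact (hc.comp (by fun_prop : Continuous fun y : Y => (y, e))).aestronglyMeasurable
  · exact (ae_restrict_iff' hC.measurableSet).2 (Filter.Eventually.of_forall hMb)
  · exact (continuousOn_const).integrableOn_compact hC
  · filter_upwards with y z _
    exact (hf.2.1 (x, y) z).hasFDerivAt

theorem ContFamily.iteratedFDeriv_integral (hC : IsCompact C) {p : ℕ} : ∀ {F : Type}
    [NormedAddCommGroup F] [NormedSpace ℝ F] [CompleteSpace F] {f : X × Y → E → F},
    ContFamily p f → ∀ x e, iteratedFDeriv ℝ p (fun e => ∫ y in C, f (x, y) e ∂μ) e =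
      ∫ y in C, iteratedFDeriv ℝ p (f (x, y)) e ∂μ := by
  induction p with
  | zero =>
    intro F _ _ _ f hf x e
    simp only [iteratedFDeriv_zero_eq_comp, Function.comp_def]
    exact ((continuousMultilinearCurryFin0 ℝ E F).symm.toContinuousLinearEquiv.integral_comp_comm
      (μ := μ.restrict C) fun y => f (x, y) e).symm
  | succ p ih =>
    intro F _ _ _ f hf x e
    have hf1 : ContFamily 1 f := ⟨hf.1, hf.2.1, hf.2.2.cont⟩
    have h1 : (fun e => fderiv ℝ (fun e => ∫ y in C, f (x, y) e ∂μ) e) =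
        fun e => ∫ y in C, fderiv ℝ (f (x, y)) e ∂μ :=
      funext fun e => (hf1.hasFDerivAt_integral hC x e).fderiv
    rw [iteratedFDeriv_succ_eq_comp_right, Function.comp_apply, h1, ih hf.2.2]
    simp only [iteratedFDeriv_succ_eq_comp_right, Function.comp_def]
    exact ((continuousMultilinearCurryRightEquiv' ℝ p E
      F).symm.toContinuousLinearEquiv.integral_comp_comm
      (μ := μ.restrict C) fun y => iteratedFDeriv ℝ p (fderiv ℝ (f (x, y))) e).symm

variable [LocallyCompactSpace X] [FirstCountableTopology X]

theorem ContFamily.integral (hC : IsCompact C) {p : ℕ} : ∀ {F : Type} [NormedAddCommGroup F]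
    [NormedSpace ℝ F] {f : X × Y → E → F}, ContFamily p f →
    ContFamily p (fun x e => ∫ y in C, f (x, y) e ∂μ) := by
  have : ProperSpace E := FiniteDimensional.proper ℝ E
  have h0 : ∀ {F : Type} [NormedAddCommGroup F] [NormedSpace ℝ F] {f : X × Y → E → F},
      Continuous (Function.uncurry f) →
      Continuous (Function.uncurry fun x e => ∫ y in C, f (x, y) e ∂μ) := by
    intro F _ _ f hf
    refine continuous_parametric_integral_of_continuous (μ := μ)
      (f := fun (z : X × E) (y : Y) => f (z.1, y) z.2) ?_ hC
    exact hf.comp (by fun_prop : Continuous fun w : (X × E) × Y => ((w.1.1, w.2), w.1.2))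
  induction p with
  | zero => intro F _ _ f hf; exact h0 hf
  | succ p ih =>
    intro F _ _ f hf
    have hf1 : ContFamily 1 f := ⟨hf.1, hf.2.1, hf.2.2.cont⟩
    refine ⟨h0 hf.1, fun x e => (hf1.hasFDerivAt_integral hC x e).differentiableAt, ?_⟩
    refine (congrArg _ ?_).mp (ih hf.2.2)
    funext x e
    exact (hf1.hasFDerivAt_integral hC x e).fderiv.symm

end

/-! ### Uniform bounds for the derivatives of the propagator -/

/-- Smooth functions on the line supported in `[1, 4]`. -/
structure IsShell (u : ℝ → ℝ) : Prop where
  smooth : ContDiff ℝ ∞ u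
  low : ∀ z ≤ 1, u z = 0
  high : ∀ z, 4 ≤ z → u z = 0

theorem deriv_eq_zero_of_Icc {f : ℝ → ℝ} (hf : ContDiff ℝ ∞ f) {a b c : ℝ} (hab : a < b)
    (h : ∀ z ∈ Set.Ioo a b, f z = c) : ∀ z ∈ Set.Icc a b, deriv f z = 0 := by
  intro z hz
  have hcl : IsClosed {z | deriv f z = 0} :=
    isClosed_eq (hf.continuous_deriv (by simp)) continuous_const
  rw [← closure_Ioo hab.ne] at hz
  refine hcl.closure_subset_iff.2 ?_ hz
  intro y hy
  have : f =ᶠ[nhds y] fun _ => c := by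
    filter_upwards [isOpen_Ioo.mem_nhds hy] with w hw using h w hw
  simp [this.deriv_eq]

theorem IsShell.shell_deriv {u : ℝ → ℝ} (hu : IsShell u) : IsShell (deriv u) where
  smooth := (contDiff_infty_iff_deriv.1 hu.smooth).2
  low := fun z hz => deriv_eq_zero_of_Icc hu.smooth (a := z - 1) (b := 1) (c := 0) (by linarith)
    (fun y hy => hu.low y hy.2.le) z ⟨by linarith, hz⟩
  high := fun z hz => deriv_eq_zero_of_Icc hu.smooth (a := 4) (b := z + 1) (c := 0) (by linarith)
    (fun y hy => hu.high y hy.1.le) z ⟨hz, by linarith⟩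

/-- A shell function is flat at `1`: integrating the bound for its derivative, again a shell
function, from `1` to `z` gains one power of `z - 1`. -/
theorem IsShell.exists_bound (m : ℕ) : ∀ {u : ℝ → ℝ}, IsShell u →
    ∃ C, 0 ≤ C ∧ ∀ z, 1 ≤ z → |u z| ≤ C * (z - 1) ^ m := by
  induction m with
  | zero =>
    intro u hu
    obtain ⟨C, hC⟩ := (isCompact_Icc (a := (1 : ℝ)) (b := 4)).bddAbove_image
      hu.smooth.continuous.abs.continuousOn
    refine ⟨|C|, abs_nonneg _, fun z hz => ?_⟩
    rw [pow_zero, mul_one]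
    by_cases h : z ≤ 4
    · exact (hC ⟨z, ⟨hz, h⟩, rfl⟩).trans (le_abs_self C)
    · rw [hu.high z (by linarith), abs_zero]; exact abs_nonneg _
  | succ m ih =>
    intro u hu
    obtain ⟨C, hC0, hC⟩ := ih hu.shell_deriv
    refine ⟨C, hC0, fun z hz => ?_⟩
    have h := Convex.norm_image_sub_le_of_norm_deriv_le (f := u) (C := C * (z - 1) ^ m)
      (s := Set.Icc 1 z) (x := 1) (y := z)
      (fun y _ => (hu.smooth.differentiable (by simp)).differentiableAt)
      (fun y hy => (hC y hy.1).trans ?_) (convex_Icc _ _) ⟨le_rfl, hz⟩ ⟨hz, le_rfl⟩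
    · rw [hu.low 1 le_rfl, sub_zero, Real.norm_eq_abs, Real.norm_eq_abs,
        abs_of_nonneg (by linarith : 0 ≤ z - 1)] at h
      rw [pow_succ, ← mul_assoc]
      exact h
    · have := hy.1
      have := hy.2
      gcongr

theorem IsShell.contDiff_div {u : ℝ → ℝ} (hu : IsShell u) (m : ℕ) {b : ℝ} (hb : -1 < b) :
    ContDiff ℝ ∞ fun z => u z / (z + b) ^ m := by
  rw [contDiff_iff_contDiffAt]
  intro z
  rcases lt_or_ge z 1 with hz | hz
  · refine (contDiffAt_const (c := (0 : ℝ))).congr_of_eventuallyEq ?_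
    filter_upwards [isOpen_Iio.mem_nhds hz] with y hy
    rw [hu.low y (le_of_lt hy), zero_div]
  · exact hu.smooth.contDiffAt.div (by fun_prop) (pow_ne_zero _ (by linarith))

theorem IsShell.deriv_div {u : ℝ → ℝ} (hu : IsShell u) (m : ℕ) {b : ℝ} (hb : -1 < b) :
    deriv (fun z => u z / (z + b) ^ m) =
      fun z => deriv u z / (z + b) ^ m - m * (u z / (z + b) ^ (m + 1)) := by
  funext z
  rcases lt_or_ge z 1 with hz | hz
  · have : (fun z => u z / (z + b) ^ m) =ᶠ[nhds z] fun _ => 0 := by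
      filter_upwards [isOpen_Iio.mem_nhds hz] with y hy
      rw [hu.low y (le_of_lt hy), zero_div]
    rw [this.deriv_eq, hu.low z hz.le, hu.shell_deriv.low z hz.le]
    simp
  · have hzb : z + b ≠ 0 := by linarith
    have h1 : HasDerivAt u (deriv u z) z :=
      (hu.smooth.differentiable (by simp)).differentiableAt.hasDerivAt
    have h2 : HasDerivAt (fun z => (z + b) ^ m) (m * (z + b) ^ (m - 1)) z := by
      simpa using ((hasDerivAt_id z).add_const b).fun_pow m
    rw [(h1.fun_div h2 (pow_ne_zero _ hzb)).deriv]
    cases m with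
    | zero => simp
    | succ m => simp only [Nat.add_sub_cancel]; field_simp; ring

/-- Uniformity as `b` tends to `-1` is the point: the denominator may degenerate at `z = 1`, but `z
+ b > z - 1` and the numerator vanishes there to every order. Each derivative may raise the power of
the denominator, so `m` is kept general in the induction. -/
theorem IsShell.exists_iteratedDeriv_div_bound (p : ℕ) : ∀ (m : ℕ) {u : ℝ → ℝ}, IsShell u →
    ∃ C, 0 ≤ C ∧ ∀ b, -1 < b → ∀ z, |iteratedDeriv p (fun z => u z / (z + b) ^ m) z| ≤ C := by
  induction p with
  | zero =>
    intro m u hu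
    obtain ⟨C, hC0, hC⟩ := hu.exists_bound m
    refine ⟨C, hC0, fun b hb z => ?_⟩
    rw [iteratedDeriv_zero]
    rcases lt_or_ge z 1 with hz | hz
    · rw [hu.low z hz.le]; simpa
    · rw [abs_div, abs_of_pos (pow_pos (by linarith : 0 < z + b) m),
        div_le_iff₀ (pow_pos (by linarith) m)]
      refine (hC z hz).trans ?_
      have : 0 ≤ z - 1 := by linarith
      gcongr
      linarith
  | succ p ih =>
    intro m u hu
    obtain ⟨C1, hC1, h1⟩ := ih m hu.shell_deriv
    obtain ⟨C2, hC2, h2⟩ := ih (m + 1) hu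
    refine ⟨C1 + m * C2, by positivity, fun b hb z => ?_⟩
    rw [iteratedDeriv_succ', hu.deriv_div m hb]
    have hd1 : ContDiffAt ℝ p (fun z => deriv u z / (z + b) ^ m) z :=
      ((hu.shell_deriv.contDiff_div m hb).of_le (mod_cast le_top)).contDiffAt
    have hd2 : ContDiffAt ℝ p (fun z => u z / (z + b) ^ (m + 1)) z :=
      ((hu.contDiff_div (m + 1) hb).of_le (mod_cast le_top)).contDiffAt
    have e1 := iteratedDeriv_fun_sub hd1 (contDiffAt_const.mul hd2 (f := fun _ => (m : ℝ)))
    have e2 := iteratedDeriv_const_mul (m : ℝ) hd2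
    rw [e1, e2]
    calc _ ≤ |iteratedDeriv p (fun z => deriv u z / (z + b) ^ m) z| +
          |m * iteratedDeriv p (fun z => u z / (z + b) ^ (m + 1)) z| := abs_sub _ _
      _ ≤ _ := by
        rw [abs_mul, Nat.abs_cast]
        gcongr
        exacts [h1 b hb z, h2 b hb z]

theorem contDiff_normSq : ContDiff ℝ ∞ fun x : Momentum => ‖x‖ ^ 2 := contDiff_norm_sq ℝ

theorem IsShell.exists_radial_bound {u : ℝ → ℝ} (hu : IsShell u) (p : ℕ) :
    ∃ C, 0 ≤ C ∧ ∀ b, -1 < b → ∀ x : Momentum,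
      ‖iteratedFDeriv ℝ p (fun x : Momentum => u (‖x‖ ^ 2) / (‖x‖ ^ 2 + b)) x‖ ≤ C := by
  choose c hc0 hc using fun i => hu.exists_iteratedDeriv_div_bound i 1
  have hD : ∀ i, ∃ D, ∀ x ∈ Metric.closedBall (0 : Momentum) 2,
      ‖iteratedFDeriv ℝ i (fun x : Momentum => ‖x‖ ^ 2) x‖ ≤ D := by
    intro i
    obtain ⟨D, hD⟩ := (isCompact_closedBall (0 : Momentum) 2).bddAbove_image
      (contDiff_normSq.continuous_iteratedFDeriv (m := i) (mod_cast le_top)).norm.continuousOn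
    exact ⟨D, fun x hx => hD ⟨x, hx, rfl⟩⟩
  choose D hD using hD
  -- The bound for derivatives of a composition wants the `i`-th inner derivative below `D' ^ i`;
  -- adding `1` makes `D' ≤ D' ^ i` for `i ≥ 1`.
  set D' : ℝ := 1 + ∑ i ∈ Finset.range (p + 1), |D i|
  set C' : ℝ := ∑ i ∈ Finset.range (p + 1), c i
  have hD'1 : 1 ≤ D' := by
    have : 0 ≤ ∑ i ∈ Finset.range (p + 1), |D i| := Finset.sum_nonneg fun i _ => abs_nonneg _
    simp only [D']; linarith
  have hC'0 : 0 ≤ C' := Finset.sum_nonneg fun i _ => hc0 i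
  have hnn : 0 ≤ p.factorial * C' * D' ^ p := by positivity
  refine ⟨p.factorial * C' * D' ^ p, hnn, fun b hb x => ?_⟩
  by_cases hx : ‖x‖ ≤ 2
  · have h := norm_iteratedFDeriv_comp_le (n := p) (N := ∞) (hu.contDiff_div 1 hb)
      contDiff_normSq (mod_cast le_top) x (C := C') (D := D') ?_ ?_
    · simpa only [Function.comp_def, pow_one] using h
    · intro i hi
      rw [norm_iteratedFDeriv_eq_norm_iteratedDeriv]
      exact (hc i b hb _).trans (Finset.single_le_sum (f := c) (fun j _ => hc0 j)
        (Finset.mem_range.2 (by omega)))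
    · intro i hi1 hi
      refine (hD i x (by simpa using hx)).trans ?_
      calc D i ≤ |D i| := le_abs_self _
        _ ≤ ∑ i ∈ Finset.range (p + 1), |D i| :=
          Finset.single_le_sum (f := fun i => |D i|) (fun j _ => abs_nonneg _)
            (Finset.mem_range.2 (by omega))
        _ ≤ D' := by simp [D']
        _ ≤ D' ^ i := le_self_pow₀ hD'1 (by omega)
  · have : (fun x : Momentum => u (‖x‖ ^ 2) / (‖x‖ ^ 2 + b)) =ᶠ[nhds x] fun _ => 0 := by
      have ho : IsOpen {y : Momentum | 2 < ‖y‖} := isOpen_lt continuous_const continuous_norm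
      filter_upwards [ho.mem_nhds (lt_of_not_ge hx)] with y hy
      rw [hu.high _ (by have : 2 < ‖y‖ := hy; nlinarith), zero_div]
    have h0 := this.iteratedFDeriv ℝ p
    rw [h0.eq_of_nhds]
    rw [iteratedFDeriv_fun_zero]
    simpa using hnn

/-- The profile `-2 z K'(z)` of the scale derivative of the cutoff, set to zero below `1`. -/
noncomputable def shellProfile (K : ℝ → ℝ) (z : ℝ) : ℝ := if z ≤ 1 then 0 else -2 * z * deriv K z

theorem IsCutoff.deriv_low {K : ℝ → ℝ} (hK : IsCutoff K) {z : ℝ} (h0 : 0 ≤ z) (h1 : z ≤ 1) :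
    deriv K z = 0 :=
  deriv_eq_zero_of_Icc hK.smooth one_pos (fun y hy => hK.eq_one y hy.1.le hy.2.le) z ⟨h0, h1⟩

/-- Nothing is known about `K` at negative arguments, hence the truncation in the profile. It does
not spoil smoothness because `K' = 0` on `[0, 1]`, and it is invisible at the arguments `k² / Λ² ≥
0`. -/
theorem IsCutoff.isShell {K : ℝ → ℝ} (hK : IsCutoff K) : IsShell (shellProfile K) where
  low := fun z hz => by simp [shellProfile, hz]
  high := fun z hz => by
    rw [shellProfile, if_neg (by linarith), deriv_eq_zero_of_Icc hK.smooth (a := 4) (b := z + 1)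
      (c := 0) (by linarith) (fun y hy => hK.eq_zero y hy.1.le) z ⟨hz, by linarith⟩, mul_zero]
  smooth := by
    have hd : ContDiff ℝ ∞ (deriv K) := (contDiff_infty_iff_deriv.1 hK.smooth).2
    rw [contDiff_iff_contDiffAt]
    intro z
    rcases lt_or_ge z 1 with hz | hz
    · refine (contDiffAt_const (c := (0 : ℝ))).congr_of_eventuallyEq ?_
      filter_upwards [isOpen_Iio.mem_nhds hz] with y hy
      rw [shellProfile, if_pos (le_of_lt hy)]
    · have : ContDiffAt ℝ ∞ (fun z => -2 * z * deriv K z) z := by fun_prop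
      refine this.congr_of_eventuallyEq ?_
      filter_upwards [isOpen_Ioi.mem_nhds (by linarith : (0 : ℝ) < z)] with y hy
      rw [shellProfile]
      split_ifs with h
      · rw [hK.deriv_low (le_of_lt hy) h, mul_zero]
      · rfl

theorem propagatorDeriv_eq {K : ℝ → ℝ} (hK : IsCutoff K) (B : ℝ) {Λ : ℝ} (hΛ : 0 < Λ)
    (k : Momentum) : propagatorDeriv K B Λ k =
      shellProfile K (‖k‖ ^ 2 / Λ ^ 2) / (Λ * (‖k‖ ^ 2 + B)) := by
  have hz : 0 ≤ ‖k‖ ^ 2 / Λ ^ 2 := by positivity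
  have h1 : HasDerivAt (fun s : ℝ => ‖k‖ ^ 2 / s ^ 2) (-2 * (‖k‖ ^ 2 / Λ ^ 2) / Λ) Λ := by
    have := (hasDerivAt_const Λ (‖k‖ ^ 2)).div ((hasDerivAt_id Λ).pow 2)
      (pow_ne_zero 2 hΛ.ne')
    refine this.congr_deriv ?_
    simp
    field_simp
  have h2 : HasDerivAt K (deriv K (‖k‖ ^ 2 / Λ ^ 2)) (‖k‖ ^ 2 / Λ ^ 2) :=
    (hK.smooth.differentiable (by simp)).differentiableAt.hasDerivAt
  have h3 := (h2.comp Λ h1).div_const (‖k‖ ^ 2 + B)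
  have h4 : propagatorDeriv K B Λ k =
      deriv K (‖k‖ ^ 2 / Λ ^ 2) * (-2 * (‖k‖ ^ 2 / Λ ^ 2) / Λ) / (‖k‖ ^ 2 + B) := h3.deriv
  rw [h4, shellProfile]
  split_ifs with h
  · rw [hK.deriv_low hz h]; simp
  · rw [div_mul_eq_div_div]; congr 1; ring

theorem propagatorDeriv_zero_low {K : ℝ → ℝ} (hK : IsCutoff K) (B : ℝ) {Λ : ℝ} (hΛ : 0 < Λ)
    {k : Momentum} (hk : ‖k‖ ≤ Λ) : propagatorDeriv K B Λ k = 0 := by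
  rw [propagatorDeriv_eq hK B hΛ, hK.isShell.low, zero_div]
  rw [div_le_one (by positivity)]
  gcongr

theorem propagatorDeriv_zero_high {K : ℝ → ℝ} (hK : IsCutoff K) (B : ℝ) {Λ : ℝ} (hΛ : 0 < Λ)
    {k : Momentum} (hk : 2 * Λ ≤ ‖k‖) : propagatorDeriv K B Λ k = 0 := by
  rw [propagatorDeriv_eq hK B hΛ, hK.isShell.high, zero_div]
  rw [le_div_iff₀ (by positivity)]
  calc 4 * Λ ^ 2 = (2 * Λ) ^ 2 := by ring
    _ ≤ _ := by gcongr

/-- By scaling, the function is `Λ⁻³ g(k / Λ)` with `g` the radial shell function for `b = B / Λ² >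
-1`, whose derivatives are bounded uniformly in `b`. -/
theorem exists_propagatorDeriv_bound {K : ℝ → ℝ} (hK : IsCutoff K) (p : ℕ) :
    ∃ C, 0 ≤ C ∧ ∀ B Λ, 0 < Λ → -Λ ^ 2 < B → ∀ k,
      ‖iteratedFDeriv ℝ p (propagatorDeriv K B Λ) k‖ ≤ (Λ ^ 3)⁻¹ * (Λ ^ p)⁻¹ * C := by
  obtain ⟨C, hC0, hC⟩ := hK.isShell.exists_radial_bound p
  refine ⟨C, hC0, fun B Λ hΛ hB k => ?_⟩
  have hb : -1 < B / Λ ^ 2 := by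
    rw [lt_div_iff₀ (by positivity)]; linarith
  set g : Momentum → ℝ := fun x => shellProfile K (‖x‖ ^ 2) / (‖x‖ ^ 2 + B / Λ ^ 2) with hg
  have hgs : ContDiff ℝ ∞ g := by
    have := (hK.isShell.contDiff_div 1 hb).comp contDiff_normSq
    simpa only [Function.comp_def, pow_one] using this
  let T : Momentum →L[ℝ] Momentum := Λ⁻¹ • ContinuousLinearMap.id ℝ Momentum
  have hT : ‖T‖ ≤ Λ⁻¹ := by
    refine T.opNorm_le_bound (by positivity) fun x => le_of_eq ?_
    change ‖Λ⁻¹ • x‖ = _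
    rw [norm_smul, Real.norm_of_nonneg (by positivity)]
  have he : propagatorDeriv K B Λ = (Λ ^ 3)⁻¹ • (g ∘ T) := by
    funext x
    have hx : ‖Λ⁻¹ • x‖ ^ 2 = ‖x‖ ^ 2 / Λ ^ 2 := by
      rw [norm_smul, Real.norm_of_nonneg (by positivity)]; field_simp
    have : ((Λ ^ 3)⁻¹ • (g ∘ T)) x = (Λ ^ 3)⁻¹ * (shellProfile K (‖Λ⁻¹ • x‖ ^ 2) /
      (‖Λ⁻¹ • x‖ ^ 2 + B / Λ ^ 2)) := rfl
    rw [this, propagatorDeriv_eq hK B hΛ, hx, ← add_div]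
    -- At a zero of the denominator both sides are `0` by the convention for division.
    by_cases h : ‖x‖ ^ 2 + B = 0
    · rw [h]; simp
    · field_simp
  rw [he, iteratedFDeriv_const_smul_apply ((hgs.comp T.contDiff).contDiffAt.of_le (mod_cast le_top)),
    T.iteratedFDeriv_comp_right (n := ∞) hgs k (mod_cast le_top), norm_smul,
    Real.norm_of_nonneg (by positivity), mul_assoc]
  refine mul_le_mul_of_nonneg_left ?_ (by positivity)
  refine (ContinuousMultilinearMap.norm_compContinuousLinearMap_le _ _).trans ?_
  rw [Finset.prod_const, Finset.card_univ, Fintype.card_fin, mul_comm]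
  refine mul_le_mul ?_ (hC _ hb _) (norm_nonneg _) (by positivity)
  rw [← inv_pow]
  gcongr

/-- The scale `Λ_R` is excluded: for `B = -Λ_R²` the denominator vanishes at the inner edge of the
shell when `Λ = Λ_R`. For `Λ > Λ_R` it is positive wherever `‖k‖ ≥ Λ`, and for `‖k‖ < Λ` the
function is locally zero. -/
theorem contFamily_propagatorDeriv {K : ℝ → ℝ} (hK : IsCutoff K) {B ΛR Λ0 : ℝ} (hR : 0 < ΛR)
    (hB : |B| ≤ ΛR ^ 2) (p : ℕ) :
    ContFamily p fun (Λ : Set.Ioc ΛR Λ0) k => propagatorDeriv K B Λ k := by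
  refine contFamily_of_contDiffOn (U := Set.Ioi ΛR) isOpen_Ioi (fun x hx => hx.1)
    (g := fun y : ℝ × Momentum => propagatorDeriv K B y.1 y.2) ?_
  have hUo : IsOpen (Set.Ioi ΛR ×ˢ (Set.univ : Set Momentum)) := isOpen_Ioi.prod isOpen_univ
  have hf : ContDiffOn ℝ ∞ (fun y : ℝ × Momentum => shellProfile K (‖y.2‖ ^ 2 / y.1 ^ 2) /
      (y.1 * (‖y.2‖ ^ 2 + B))) (Set.Ioi ΛR ×ˢ Set.univ) := by
    rintro ⟨Λ, k⟩ ⟨hΛ, -⟩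
    have hΛR : ΛR < Λ := hΛ
    have hΛ0 : 0 < Λ := hR.trans hΛR
    refine ContDiffAt.contDiffWithinAt ?_
    rcases lt_or_ge ‖k‖ Λ with h | h
    · refine (contDiffAt_const (c := (0 : ℝ))).congr_of_eventuallyEq ?_
      have ho : IsOpen {y : ℝ × Momentum | 0 < y.1 ∧ ‖y.2‖ < y.1} :=
        (isOpen_lt continuous_const continuous_fst).inter
          (isOpen_lt continuous_snd.norm continuous_fst)
      filter_upwards [ho.mem_nhds ⟨hΛ0, h⟩] with y hy
      rw [hK.isShell.low, zero_div]
      have := hy.1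
      rw [div_le_one (by positivity)]
      have := hy.2.le
      gcongr
    · have hn : ContDiff ℝ ∞ fun y : ℝ × Momentum => ‖y.2‖ ^ 2 :=
        contDiff_normSq.comp contDiff_snd
      have h1 : ContDiffAt ℝ ∞ (fun y : ℝ × Momentum => ‖y.2‖ ^ 2 / y.1 ^ 2) (Λ, k) :=
        hn.contDiffAt.div (contDiff_fst.contDiffAt.pow 2) (pow_ne_zero _ hΛ0.ne')
      have h2 : ContDiffAt ℝ ∞ (fun y : ℝ × Momentum => shellProfile K (‖y.2‖ ^ 2 / y.1 ^ 2))
          (Λ, k) := hK.isShell.smooth.contDiffAt.comp _ h1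
      refine h2.div (contDiff_fst.contDiffAt.mul (hn.contDiffAt.add contDiffAt_const))
        (mul_ne_zero hΛ0.ne' ?_)
      have h3 : ΛR ^ 2 < ‖k‖ ^ 2 := by
        have : ΛR < ‖k‖ := hΛR.trans_le h
        gcongr
      have h4 := (abs_le.1 hB).1
      have : 0 < ‖k‖ ^ 2 + B := by linarith
      exact this.ne'
  exact hf.congr fun y hy => propagatorDeriv_eq hK B (hR.trans hy.1) y.2

/-! ### Polynomials in logarithms of ratios of scales -/

/-- Polynomials with nonnegative coefficients. -/
def NonnegCoeffs (P : Polynomial ℝ) : Prop := ∀ i, 0 ≤ P.coeff i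

namespace NonnegCoeffs

theorem eval_nonneg {P : Polynomial ℝ} (hP : NonnegCoeffs P) {x : ℝ} (hx : 0 ≤ x) :
    0 ≤ P.eval x := by
  rw [Polynomial.eval_eq_sum_range]
  exact Finset.sum_nonneg fun i _ => mul_nonneg (hP i) (pow_nonneg hx i)

theorem eval_mono {P : Polynomial ℝ} (hP : NonnegCoeffs P) {x y : ℝ} (hx : 0 ≤ x) (hxy : x ≤ y) :
    P.eval x ≤ P.eval y := by
  rw [Polynomial.eval_eq_sum_range, Polynomial.eval_eq_sum_range]
  refine Finset.sum_le_sum fun i _ => mul_le_mul_of_nonneg_left ?_ (hP i)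
  gcongr

theorem add {P Q : Polynomial ℝ} (hP : NonnegCoeffs P) (hQ : NonnegCoeffs Q) :
    NonnegCoeffs (P + Q) := fun i => by
  rw [Polynomial.coeff_add]; exact add_nonneg (hP i) (hQ i)

theorem mul {P Q : Polynomial ℝ} (hP : NonnegCoeffs P) (hQ : NonnegCoeffs Q) :
    NonnegCoeffs (P * Q) := fun i => by
  rw [Polynomial.coeff_mul]; exact Finset.sum_nonneg fun x _ => mul_nonneg (hP _) (hQ _)

theorem C {c : ℝ} (hc : 0 ≤ c) : NonnegCoeffs (Polynomial.C c) := fun i => by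
  rw [Polynomial.coeff_C]; split_ifs <;> simp [hc]

theorem X : NonnegCoeffs Polynomial.X := fun i => by
  rw [Polynomial.coeff_X]; split_ifs <;> simp

theorem zero : NonnegCoeffs 0 := fun i => by simp

theorem derivative {P : Polynomial ℝ} (hP : NonnegCoeffs P) :
    NonnegCoeffs (Polynomial.derivative P) := fun i => by
  rw [Polynomial.coeff_derivative]; exact mul_nonneg (hP _) (by positivity)

/-- The solution is the finite sum `T = P + P' + P'' + ⋯`. It yields `-T(ln s) / s` as a primitive
of `P(ln s) / s²`. -/
theorem exists_sub_derivative (d : ℕ) : ∀ {P : Polynomial ℝ}, NonnegCoeffs P → P.natDegree ≤ d →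
    ∃ T, NonnegCoeffs T ∧ T - Polynomial.derivative T = P := by
  induction d with
  | zero =>
    intro P hP hd
    refine ⟨P, hP, ?_⟩
    rw [Polynomial.derivative_of_natDegree_zero (by omega), sub_zero]
  | succ d ih =>
    intro P hP hd
    obtain ⟨T, hT, h⟩ := ih hP.derivative ((Polynomial.natDegree_derivative_le P).trans (by omega))
    refine ⟨P + T, hP.add hT, ?_⟩
    rw [Polynomial.derivative_add, ← h]
    ring

end NonnegCoeffs

/-- The bound `P(ln(Λ/Λ_R)) + (Λ/Λ₀) Q(ln(Λ₀/Λ_R))`. -/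
noncomputable def plnBound (P Q : Polynomial ℝ) (ΛR Λ Λ0 : ℝ) : ℝ :=
  P.eval (Real.log (Λ / ΛR)) + Λ / Λ0 * Q.eval (Real.log (Λ0 / ΛR))

/-- Nonnegative functions of the scales bounded by some `plnBound P Q`. -/
def IsPln (φ : ℝ → ℝ → ℝ → ℝ) : Prop :=
  ∃ P Q : Polynomial ℝ, NonnegCoeffs P ∧ NonnegCoeffs Q ∧ ∀ ΛR Λ Λ0, 0 < ΛR → ΛR ≤ Λ → Λ ≤ Λ0 →
    0 ≤ φ ΛR Λ Λ0 ∧ φ ΛR Λ Λ0 ≤ plnBound P Q ΛR Λ Λ0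

theorem log_ratio_nonneg {a b : ℝ} (ha : 0 < a) (hab : a ≤ b) : 0 ≤ Real.log (b / a) :=
  Real.log_nonneg ((one_le_div ha).2 hab)

theorem log_ratio_mono {a b c : ℝ} (ha : 0 < a) (hab : a ≤ b) (hbc : b ≤ c) :
    Real.log (b / a) ≤ Real.log (c / a) :=
  Real.log_le_log (div_pos (ha.trans_le hab) ha) (by gcongr)

theorem plnBound_nonneg {P Q : Polynomial ℝ} (hP : NonnegCoeffs P) (hQ : NonnegCoeffs Q)
    {ΛR Λ Λ0 : ℝ} (h0 : 0 < ΛR) (h1 : ΛR ≤ Λ) (h2 : Λ ≤ Λ0) : 0 ≤ plnBound P Q ΛR Λ Λ0 := by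
  have := hP.eval_nonneg (log_ratio_nonneg h0 h1)
  have := hQ.eval_nonneg (log_ratio_nonneg h0 (h1.trans h2))
  have : 0 < Λ := h0.trans_le h1
  have : 0 < Λ0 := this.trans_le h2
  unfold plnBound
  positivity

theorem isPln_plnBound {P Q : Polynomial ℝ} (hP : NonnegCoeffs P) (hQ : NonnegCoeffs Q) :
    IsPln (plnBound P Q) :=
  ⟨P, Q, hP, hQ, fun _ _ _ h0 h1 h2 => ⟨plnBound_nonneg hP hQ h0 h1 h2, le_rfl⟩⟩

theorem IsPln.add {φ ψ : ℝ → ℝ → ℝ → ℝ} (hφ : IsPln φ) (hψ : IsPln ψ) :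
    IsPln fun ΛR Λ Λ0 => φ ΛR Λ Λ0 + ψ ΛR Λ Λ0 := by
  obtain ⟨P, Q, hP, hQ, h⟩ := hφ
  obtain ⟨P', Q', hP', hQ', h'⟩ := hψ
  refine ⟨P + P', Q + Q', hP.add hP', hQ.add hQ', fun ΛR Λ Λ0 h0 h1 h2 => ?_⟩
  have e := h ΛR Λ Λ0 h0 h1 h2
  have e' := h' ΛR Λ Λ0 h0 h1 h2
  refine ⟨add_nonneg e.1 e'.1, (add_le_add e.2 e'.2).trans (le_of_eq ?_)⟩
  simp only [plnBound, Polynomial.eval_add]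
  ring

/-- Cross terms carry a factor `Λ / Λ₀` and their logarithms of `Λ / Λ_R` can be enlarged to
logarithms of `Λ₀ / Λ_R`; the square of `Λ / Λ₀` is at most `Λ / Λ₀`. -/
theorem IsPln.mul {φ ψ : ℝ → ℝ → ℝ → ℝ} (hφ : IsPln φ) (hψ : IsPln ψ) :
    IsPln fun ΛR Λ Λ0 => φ ΛR Λ Λ0 * ψ ΛR Λ Λ0 := by
  obtain ⟨P, Q, hP, hQ, h⟩ := hφ
  obtain ⟨P', Q', hP', hQ', h'⟩ := hψ
  refine ⟨P * P', P * Q' + Q * P' + Q * Q', hP.mul hP',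
    ((hP.mul hQ').add (hQ.mul hP')).add (hQ.mul hQ'), fun ΛR Λ Λ0 h0 h1 h2 => ?_⟩
  have e := h ΛR Λ Λ0 h0 h1 h2
  have e' := h' ΛR Λ Λ0 h0 h1 h2
  have hΛ : 0 < Λ := h0.trans_le h1
  have hΛ0 : 0 < Λ0 := hΛ.trans_le h2
  refine ⟨mul_nonneg e.1 e'.1, (mul_le_mul e.2 e'.2 e'.1 (e.1.trans e.2)).trans ?_⟩
  simp only [plnBound, Polynomial.eval_add, Polynomial.eval_mul]
  have l0 := log_ratio_nonneg h0 h1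
  have l1 := log_ratio_mono h0 h1 h2
  have p1 := hP.eval_nonneg l0
  have p2 := hP.eval_mono l0 l1
  have p1' := hP'.eval_nonneg l0
  have p2' := hP'.eval_mono l0 l1
  have q := hQ.eval_nonneg (l0.trans l1)
  have q' := hQ'.eval_nonneg (l0.trans l1)
  have t0 : 0 ≤ Λ / Λ0 := by positivity
  have t1 : Λ / Λ0 ≤ 1 := (div_le_one hΛ0).2 h2
  set a := P.eval (Real.log (Λ / ΛR))
  set a1 := P.eval (Real.log (Λ0 / ΛR))
  set b := Q.eval (Real.log (Λ0 / ΛR))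
  set a' := P'.eval (Real.log (Λ / ΛR))
  set a1' := P'.eval (Real.log (Λ0 / ΛR))
  set b' := Q'.eval (Real.log (Λ0 / ΛR))
  set t := Λ / Λ0
  have e1 : a * b' ≤ a1 * b' := by gcongr
  have e2 : b * a' ≤ b * a1' := by gcongr
  have e3 : t * (b * b') ≤ b * b' := mul_le_of_le_one_left (mul_nonneg q q') t1
  calc (a + t * b) * (a' + t * b') = a * a' + t * (a * b' + b * a' + t * (b * b')) := by ring
    _ ≤ a * a' + t * (a1 * b' + b * a1' + b * b') := by gcongr

theorem isPln_const {c : ℝ} (hc : 0 ≤ c) : IsPln fun _ _ _ => c :=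
  ⟨Polynomial.C c, 0, .C hc, .zero, fun ΛR Λ Λ0 _ _ _ => ⟨hc, by simp [plnBound]⟩⟩

theorem IsPln.sum {ι : Type} (s : Finset ι) {φ : ι → ℝ → ℝ → ℝ → ℝ} (h : ∀ i ∈ s, IsPln (φ i)) :
    IsPln fun ΛR Λ Λ0 => ∑ i ∈ s, φ i ΛR Λ Λ0 := by
  classical
  induction s using Finset.induction_on with
  | empty => simpa using isPln_const le_rfl
  | insert a s ha ih =>
    simp only [Finset.sum_insert ha]
    exact (h a (by simp)).add (ih fun i hi => h i (by simp [hi]))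

theorem hasDerivAt_log_ratio {a s : ℝ} (ha : 0 < a) (hs : 0 < s) :
    HasDerivAt (fun s => Real.log (s / a)) s⁻¹ s := by
  have h := ((hasDerivAt_id s).div_const a).log (div_pos hs ha).ne'
  refine h.congr_deriv ?_
  simp only [id]
  field_simp

/-- Integration of the flow from `Λ` up to `Λ₀` for irrelevant terms. -/
theorem exists_primitive_irrelevant {P Q : Polynomial ℝ} (hP : NonnegCoeffs P)
    (hQ : NonnegCoeffs Q) :
    ∃ P' Q' : Polynomial ℝ, NonnegCoeffs P' ∧ NonnegCoeffs Q' ∧ ∀ (e : ℤ), e ≤ -1 →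
      ∀ ΛR Λ Λ0, 0 < ΛR → ΛR ≤ Λ → Λ ≤ Λ0 → ∃ φ ψ : ℝ → ℝ,
        (∀ s ∈ Set.Icc Λ Λ0, HasDerivAt φ (ψ s) s) ∧ ContinuousOn ψ (Set.Icc Λ Λ0) ∧
        (∀ s ∈ Set.Icc Λ Λ0, s ^ (e - 1) * plnBound P Q ΛR s Λ0 ≤ ψ s) ∧
        φ Λ0 - φ Λ ≤ Λ ^ e * plnBound P' Q' ΛR Λ Λ0 := by
  obtain ⟨T, hT, hTP⟩ := NonnegCoeffs.exists_sub_derivative P.natDegree hP le_rfl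
  refine ⟨T, Q * Polynomial.X, hT, hQ.mul .X, fun e he ΛR Λ Λ0 h0 h1 h2 => ?_⟩
  have hΛ : 0 < Λ := h0.trans_le h1
  have hΛ0 : 0 < Λ0 := hΛ.trans_le h2
  set q := Q.eval (Real.log (Λ0 / ΛR)) with hq
  have hq0 : 0 ≤ q := hQ.eval_nonneg (log_ratio_nonneg h0 (h1.trans h2))
  -- Since `e + 1 ≤ 0`, the factor `s ^ (e + 1)` is at most `Λ ^ (e + 1)`, which reduces everything
  -- to `e = -1`. There the `Q` part of the integrand is a constant times `1 / s`, which costs one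
  -- logarithm and explains `Q * X`.
  refine ⟨fun s => Λ ^ (e + 1) * (-(s⁻¹ * T.eval (Real.log (s / ΛR))) +
      Λ0⁻¹ * q * Real.log (s / ΛR)),
    fun s => Λ ^ (e + 1) * ((s ^ 2)⁻¹ * plnBound P Q ΛR s Λ0), ?_, ?_, ?_, ?_⟩
  · intro s hs
    have hs0 : 0 < s := hΛ.trans_le hs.1
    have hl := hasDerivAt_log_ratio h0 hs0
    have hT' := (T.hasDerivAt (Real.log (s / ΛR))).comp s hl
    have h := ((((hasDerivAt_inv hs0.ne').mul hT').neg).add (hl.const_mul (Λ0⁻¹ * q))).const_mul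
      (Λ ^ (e + 1))
    refine h.congr_deriv ?_
    simp only [Function.comp_apply, plnBound, ← hTP, Polynomial.eval_sub, ← hq]
    field_simp
    ring
  · have hc : ContinuousOn (fun s => Real.log (s / ΛR)) (Set.Icc Λ Λ0) := fun s hs =>
      (hasDerivAt_log_ratio h0 (hΛ.trans_le hs.1)).continuousAt.continuousWithinAt
    have hc2 : ContinuousOn (fun s : ℝ => (s ^ 2)⁻¹) (Set.Icc Λ Λ0) :=
      (continuousOn_id.pow 2).inv₀ fun s hs => pow_ne_zero 2 (hΛ.trans_le hs.1).ne'
    have hc3 : ContinuousOn (fun s => P.eval (Real.log (s / ΛR))) (Set.Icc Λ Λ0) :=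
      P.continuous.comp_continuousOn hc
    unfold plnBound
    fun_prop
  · intro s hs
    have hs0 : 0 < s := hΛ.trans_le hs.1
    have hb := plnBound_nonneg hP hQ h0 (h1.trans hs.1) hs.2
    have h3 : s ^ (e - 1) = s ^ (e + 1) * (s ^ 2)⁻¹ := by
      rw [show e - 1 = (e + 1) + (-2) by ring, zpow_add₀ hs0.ne']
      rfl
    rw [h3, mul_assoc]
    refine mul_le_mul_of_nonneg_right ?_ (by positivity)
    obtain ⟨m, hm⟩ : ∃ m : ℕ, e + 1 = -m := ⟨(-(e + 1)).toNat, by omega⟩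
    rw [hm, zpow_neg, zpow_neg, zpow_natCast, zpow_natCast]
    have := hs.1
    gcongr
  · have hTn := hT.eval_nonneg (log_ratio_nonneg h0 (h1.trans h2))
    have hl := log_ratio_nonneg h0 h1
    have hz : Λ ^ e = Λ ^ (e + 1) * Λ⁻¹ := by
      rw [zpow_add_one₀ hΛ.ne']; field_simp
    have hz0 : 0 ≤ Λ ^ (e + 1) := by positivity
    simp only [plnBound, hz, Polynomial.eval_mul, Polynomial.eval_X, ← hq, ← mul_sub]
    rw [mul_assoc (Λ ^ (e + 1)) Λ⁻¹]
    refine mul_le_mul_of_nonneg_left ?_ hz0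
    -- These two boundary contributions enter with a minus sign and are dropped.
    have e1 : 0 ≤ Λ0⁻¹ * T.eval (Real.log (Λ0 / ΛR)) := by positivity
    have e2 : 0 ≤ Λ0⁻¹ * q * Real.log (Λ / ΛR) := by positivity
    have e3 : Λ⁻¹ * (T.eval (Real.log (Λ / ΛR)) + Λ / Λ0 * (q * Real.log (Λ0 / ΛR))) =
      Λ⁻¹ * T.eval (Real.log (Λ / ΛR)) + Λ0⁻¹ * q * Real.log (Λ0 / ΛR) := by field_simp
    rw [e3]
    linarith

/-- Integration of the flow from `Λ_R` up to `Λ` for relevant and marginal terms. -/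
theorem exists_primitive_relevant {P Q : Polynomial ℝ} (hP : NonnegCoeffs P)
    (hQ : NonnegCoeffs Q) :
    ∃ P' Q' : Polynomial ℝ, NonnegCoeffs P' ∧ NonnegCoeffs Q' ∧ ∀ (e : ℤ), 0 ≤ e →
      ∀ ΛR Λ Λ0, 0 < ΛR → ΛR ≤ Λ → Λ ≤ Λ0 → ∃ φ ψ : ℝ → ℝ,
        (∀ s ∈ Set.Icc ΛR Λ, HasDerivAt φ (ψ s) s) ∧ ContinuousOn ψ (Set.Icc ΛR Λ) ∧
        (∀ s ∈ Set.Icc ΛR Λ, s ^ (e - 1) * plnBound P Q ΛR s Λ0 ≤ ψ s) ∧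
        φ Λ - φ ΛR ≤ Λ ^ e * plnBound P' Q' ΛR Λ Λ0 := by
  refine ⟨P * Polynomial.X, Q, hP.mul .X, hQ, fun e he ΛR Λ Λ0 h0 h1 h2 => ?_⟩
  have hΛ : 0 < Λ := h0.trans_le h1
  have hΛ0 : 0 < Λ0 := hΛ.trans_le h2
  set q := Q.eval (Real.log (Λ0 / ΛR)) with hq
  set b := P.eval (Real.log (Λ / ΛR)) with hb
  have hq0 : 0 ≤ q := hQ.eval_nonneg (log_ratio_nonneg h0 (h1.trans h2))
  have hb0 : 0 ≤ b := hP.eval_nonneg (log_ratio_nonneg h0 h1)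
  -- Here `s ^ e ≤ Λ ^ e`, and the logarithms in `P` are frozen at their largest value `b`.
  -- Integrating `b / s` gives the extra factor `X`; the `Q` part integrates to at most `q Λ / Λ₀`.
  refine ⟨fun s => Λ ^ e * (b * Real.log (s / ΛR) + Λ0⁻¹ * q * s),
    fun s => Λ ^ e * (b * s⁻¹ + Λ0⁻¹ * q), ?_, ?_, ?_, ?_⟩
  · intro s hs
    have hl := hasDerivAt_log_ratio h0 (h0.trans_le hs.1)
    have h := ((hl.const_mul b).add ((hasDerivAt_id s).const_mul (Λ0⁻¹ * q))).const_mul (Λ ^ e)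
    exact h.congr_deriv (by ring)
  · have hc2 : ContinuousOn (fun s : ℝ => s⁻¹) (Set.Icc ΛR Λ) :=
      continuousOn_id.inv₀ fun s hs => (h0.trans_le hs.1).ne'
    fun_prop
  · intro s hs
    have hs0 : 0 < s := h0.trans_le hs.1
    have h3 : s ^ (e - 1) = s ^ e * s⁻¹ := by rw [zpow_sub_one₀ hs0.ne']
    have h4 : P.eval (Real.log (s / ΛR)) ≤ b :=
      hP.eval_mono (log_ratio_nonneg h0 hs.1) (log_ratio_mono h0 hs.1 hs.2)
    have h5 : s ^ e ≤ Λ ^ e := by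
      obtain ⟨m, rfl⟩ := Int.eq_ofNat_of_zero_le he
      have := hs.2
      rw [zpow_natCast, zpow_natCast]
      gcongr
    rw [h3, plnBound, ← hq]
    calc s ^ e * s⁻¹ * (P.eval (Real.log (s / ΛR)) + s / Λ0 * q)
        ≤ s ^ e * s⁻¹ * (b + s / Λ0 * q) := by gcongr
      _ = s ^ e * (b * s⁻¹ + Λ0⁻¹ * q) := by field_simp
      _ ≤ Λ ^ e * (b * s⁻¹ + Λ0⁻¹ * q) := by gcongr
  · rw [plnBound, Polynomial.eval_mul, Polynomial.eval_X, ← hq, ← hb, ← mul_sub]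
    refine mul_le_mul_of_nonneg_left ?_ (by positivity)
    rw [div_self h0.ne', Real.log_one]
    have : 0 ≤ Λ0⁻¹ * q * ΛR := by positivity
    have e3 : Λ / Λ0 * q = Λ0⁻¹ * q * Λ := by field_simp
    rw [e3]
    linarith

/-! ### The momentum maps as continuous linear maps -/

theorem coe_norm_le {n : ℕ} (k : MomentumSpace n) (i : Fin n) : ‖k.1 i‖ ≤ ‖k‖ :=
  norm_le_pi_norm k.1 i

theorem norm_le_of_forall_coe {n : ℕ} {k : MomentumSpace n} {c : ℝ} (hc : 0 ≤ c)
    (h : ∀ i, ‖k.1 i‖ ≤ c) : ‖k‖ ≤ c :=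
  (pi_norm_le_iff_of_nonneg hc).2 h

theorem norm_sum_momenta_le {n : ℕ} (k : MomentumSpace n) (I : Finset (Fin n)) :
    ‖∑ i ∈ I, k.1 i‖ ≤ (n + 1) * ‖k‖ := by
  calc ‖∑ i ∈ I, k.1 i‖ ≤ ∑ i ∈ I, ‖k.1 i‖ := norm_sum_le _ _
    _ ≤ ∑ i : Fin n, ‖k‖ := by
      refine (Finset.sum_le_sum fun i _ => coe_norm_le k i).trans ?_
      exact Finset.sum_le_sum_of_subset_of_nonneg (Finset.subset_univ _) fun _ _ _ => norm_nonneg _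
    _ = n * ‖k‖ := by simp
    _ ≤ (n + 1) * ‖k‖ := by nlinarith [norm_nonneg k]

/-- `k ↦ ∑_{i ∈ I} k_i`. -/
noncomputable def channelMap {n : ℕ} (I : Finset (Fin n)) : MomentumSpace n →L[ℝ] Momentum :=
  LinearMap.toContinuousLinearMap
    { toFun := fun k => ∑ i ∈ I, k.1 i
      map_add' := fun a b => by simp [Finset.sum_add_distrib]
      map_smul' := fun c a => by simp [Finset.smul_sum] }

theorem norm_channelMap_le {n : ℕ} (I : Finset (Fin n)) : ‖channelMap I‖ ≤ n + 1 :=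
  ContinuousLinearMap.opNorm_le_bound _ (by positivity) fun k => norm_sum_momenta_le k I

/-- `k ↦ (k_I, -∑_{i ∈ I} k_i)`. -/
noncomputable def branchMap {n : ℕ} (I : Finset (Fin n)) :
    MomentumSpace n →L[ℝ] MomentumSpace (I.card + 1) :=
  LinearMap.toContinuousLinearMap
    { toFun := fun k => branchMomenta k I
      map_add' := fun a b => by
        refine Subtype.ext (funext fun i => ?_)
        refine Fin.lastCases ?_ (fun i => ?_) i
        · simp [branchMomenta, Finset.sum_add_distrib, add_comm]
        · simp [branchMomenta]
      map_smul' := fun c a => by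
        refine Subtype.ext (funext fun i => ?_)
        refine Fin.lastCases ?_ (fun i => ?_) i
        · simp [branchMomenta, Finset.smul_sum]
        · simp [branchMomenta] }

theorem branchMap_apply {n : ℕ} (I : Finset (Fin n)) (k : MomentumSpace n) :
    branchMap I k = branchMomenta k I := rfl

theorem norm_branchMap_le {n : ℕ} (I : Finset (Fin n)) : ‖branchMap I‖ ≤ n + 1 := by
  refine ContinuousLinearMap.opNorm_le_bound _ (by positivity) fun k => ?_
  refine norm_le_of_forall_coe (by positivity) fun i => ?_
  rw [branchMap_apply]
  refine Fin.lastCases ?_ (fun i => ?_) i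
  · simp only [branchMomenta, Fin.snoc_last, norm_neg]
    exact norm_sum_momenta_le k I
  · simp only [branchMomenta, Fin.snoc_castSucc]
    refine (coe_norm_le k _).trans ?_
    nlinarith [norm_nonneg k, (Nat.cast_nonneg n : (0 : ℝ) ≤ n)]

/-- `k ↦ (k, 0, 0)`. -/
noncomputable def loopMap (n : ℕ) : MomentumSpace n →L[ℝ] MomentumSpace (n + 2) :=
  LinearMap.toContinuousLinearMap
    { toFun := fun k => loopMomenta k 0
      map_add' := fun a b => by
        refine Subtype.ext (funext fun i => ?_)
        refine Fin.lastCases ?_ (fun i => Fin.lastCases ?_ (fun i => ?_) i) i <;>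
          simp [loopMomenta]
      map_smul' := fun c a => by
        refine Subtype.ext (funext fun i => ?_)
        refine Fin.lastCases ?_ (fun i => Fin.lastCases ?_ (fun i => ?_) i) i <;>
          simp [loopMomenta] }

theorem loopMomenta_eq {n : ℕ} (k : MomentumSpace n) (q : Momentum) :
    loopMomenta k q = loopMap n k + loopMomenta 0 q := by
  change loopMomenta k q = loopMomenta k 0 + loopMomenta 0 q
  refine Subtype.ext (funext fun i => ?_)
  refine Fin.lastCases ?_ (fun i => Fin.lastCases ?_ (fun i => ?_) i) i <;> simp [loopMomenta]

theorem norm_loopMap_le (n : ℕ) : ‖loopMap n‖ ≤ 1 := by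
  refine ContinuousLinearMap.opNorm_le_bound _ (by positivity) fun k => ?_
  rw [one_mul]
  refine norm_le_of_forall_coe (by positivity) fun i => ?_
  change ‖(loopMomenta k 0).1 i‖ ≤ ‖k‖
  refine Fin.lastCases ?_ (fun i => Fin.lastCases ?_ (fun i => ?_) i) i
  · simp [loopMomenta]
  · simp [loopMomenta]
  · simpa [loopMomenta] using coe_norm_le k i

theorem continuous_loopMomenta_zero (n : ℕ) :
    Continuous fun q : Momentum => loopMomenta (0 : MomentumSpace n) q := by
  refine Continuous.subtype_mk (continuous_pi fun i => ?_) _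
  refine Fin.lastCases ?_ (fun i => Fin.lastCases ?_ (fun i => ?_) i) i
  · simpa using continuous_neg
  · simpa using continuous_id'
  · simpa using continuous_const

theorem mem_momentumRegion {n : ℕ} {Λ : ℝ} (hΛ : 0 ≤ Λ) {k : MomentumSpace n} :
    k ∈ momentumRegion n Λ ↔ ∀ i, ‖k.1 i‖ ≤ 2 * Λ := by
  refine forall_congr' fun i => ?_
  rw [show 4 * Λ ^ 2 = (2 * Λ) ^ 2 by ring]
  exact pow_le_pow_iff_left₀ (norm_nonneg _) (by positivity) two_ne_zero

theorem branchMomenta_mem {n : ℕ} {Λ : ℝ} (hΛ : 0 ≤ Λ) {k : MomentumSpace n}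
    (hk : k ∈ momentumRegion n Λ) {I : Finset (Fin n)} (hI : ‖∑ i ∈ I, k.1 i‖ ≤ 2 * Λ) :
    branchMomenta k I ∈ momentumRegion _ Λ := by
  rw [mem_momentumRegion hΛ] at *
  intro i
  refine Fin.lastCases ?_ (fun i => ?_) i
  · simpa [branchMomenta] using hI
  · simpa [branchMomenta] using hk _

theorem loopMomenta_mem {n : ℕ} {Λ : ℝ} (hΛ : 0 ≤ Λ) {k : MomentumSpace n}
    (hk : k ∈ momentumRegion n Λ) {q : Momentum} (hq : ‖q‖ ≤ 2 * Λ) :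
    loopMomenta k q ∈ momentumRegion _ Λ := by
  rw [mem_momentumRegion hΛ] at *
  intro i
  refine Fin.lastCases ?_ (fun i => Fin.lastCases ?_ (fun i => ?_) i) i
  · simpa [loopMomenta] using hq
  · simpa [loopMomenta] using hq
  · simpa [loopMomenta] using hk i

theorem norm_sum_compl {n : ℕ} (k : MomentumSpace n) (I : Finset (Fin n)) :
    ‖∑ i ∈ Iᶜ, k.1 i‖ = ‖∑ i ∈ I, k.1 i‖ := by
  have h := Finset.sum_add_sum_compl I k.1
  rw [mem_momentumSpace.1 k.2] at h
  rw [eq_neg_of_add_eq_zero_right h, norm_neg]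

/-! ### Bounds for derivatives of compositions and products -/

theorem norm_iteratedFDeriv_comp_clm_le {E E' F : Type} [NormedAddCommGroup E] [NormedSpace ℝ E]
    [NormedAddCommGroup E'] [NormedSpace ℝ E'] [NormedAddCommGroup F] [NormedSpace ℝ F]
    {f : E → F} (hf : ContDiff ℝ ∞ f) (T : E' →L[ℝ] E) {c : ℝ} (hT : ‖T‖ ≤ c) (j : ℕ) (k : E') :
    ‖iteratedFDeriv ℝ j (fun k => f (T k)) k‖ ≤ ‖iteratedFDeriv ℝ j f (T k)‖ * c ^ j := by
  have h := T.iteratedFDeriv_comp_right (n := ∞) hf k (i := j) (mod_cast le_top)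
  simp only [Function.comp_def] at h
  rw [h]
  refine (ContinuousMultilinearMap.norm_compContinuousLinearMap_le _ _).trans ?_
  rw [Finset.prod_const, Finset.card_univ, Fintype.card_fin]
  gcongr

/-- The Leibniz rule respects the scaling, because the weights `Λ⁻ⁱ` and `Λ^{-(p-i)}` always
multiply to `Λ⁻ᵖ`. -/
theorem norm_iteratedFDeriv_mul_le_weighted {E : Type} [NormedAddCommGroup E] [NormedSpace ℝ E]
    {f g : E → ℝ} (hf : ContDiff ℝ ∞ f) (hg : ContDiff ℝ ∞ g) {k : E} {p : ℕ} {a b Λ : ℝ}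
    {φ ψ : ℕ → ℝ}
    (h1 : ∀ j ≤ p, ‖iteratedFDeriv ℝ j f k‖ ≤ a * (Λ ^ j)⁻¹ * φ j)
    (h2 : ∀ j ≤ p, ‖iteratedFDeriv ℝ j g k‖ ≤ b * (Λ ^ j)⁻¹ * ψ j) :
    ‖iteratedFDeriv ℝ p (fun k => f k * g k) k‖ ≤
      a * b * (Λ ^ p)⁻¹ * ∑ i ∈ Finset.range (p + 1), (p.choose i : ℝ) * (φ i * ψ (p - i)) := by
  refine (norm_iteratedFDeriv_mul_le (N := ∞) hf hg k (mod_cast le_top)).trans ?_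
  rw [Finset.mul_sum]
  refine Finset.sum_le_sum fun i hi => ?_
  have hip : i ≤ p := Nat.lt_succ_iff.1 (Finset.mem_range.1 hi)
  have e1 := h1 i hip
  have e2 := h2 (p - i) (Nat.sub_le p i)
  have e3 : (Λ ^ p)⁻¹ = (Λ ^ i)⁻¹ * (Λ ^ (p - i))⁻¹ := by
    rw [← mul_inv, ← pow_add, Nat.add_sub_cancel' hip]
  calc _ = (p.choose i : ℝ) * (‖iteratedFDeriv ℝ i f k‖ * ‖iteratedFDeriv ℝ (p - i) g k‖) := by ring
    _ ≤ (p.choose i : ℝ) * ((a * (Λ ^ i)⁻¹ * φ i) * (b * (Λ ^ (p - i))⁻¹ * ψ (p - i))) := by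
      refine mul_le_mul_of_nonneg_left ?_ (by positivity)
      exact mul_le_mul e1 e2 (norm_nonneg _) ((norm_nonneg _).trans e1)
    _ = _ := by rw [e3]; ring

/-! ### Bounds uniform over all solutions of the flow equation -/

/-- A solution of the flow equation satisfying the renormalization conditions at `Λ_R` and the
bounds on the irrelevant terms at `Λ₀` up to the order `(R₁, R₂)`. -/
structure FlowData (K : ℝ → ℝ) (N : ℕ → ℕ → ℕ) (P₀ : ℕ → ℕ → ℕ → ℕ → Polynomial ℝ)
    (R₁ R₂ : ℕ) where
  (ΛR Λ0 A B : ℝ)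
  L : VertexCoefficients
  pos : 0 < ΛR
  le : ΛR ≤ Λ0
  abs_B_le : |B| ≤ ΛR ^ 2
  sol : IsPerturbativeSolution K A B N ΛR Λ0 L
  ren : RenormalizationConditions ΛR L
  initial : ∀ s₁ s₂ m q : ℕ, s₁ ≤ R₁ → s₂ ≤ R₂ → 1 ≤ m → 5 ≤ m + q →
    ∀ (i j : Fin q → Fin m) (μ : Fin q → Fin 4),
      vertexNorm Λ0 (momentumDeriv i j μ (dimensionless L s₁ s₂ m Λ0))
        ≤ (Λ0 ^ q)⁻¹ * (Λ0 / ΛR) ^ s₁ * (P₀ s₁ s₂ m q).eval (Real.log (Λ0 / ΛR))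

section

variable {K : ℝ → ℝ} {N : ℕ → ℕ → ℕ} {P₀ : ℕ → ℕ → ℕ → ℕ → Polynomial ℝ} {R₁ R₂ : ℕ}

theorem FlowData.contFamily (D : FlowData K N P₀ R₁ R₂) (s t : ℕ) {n : ℕ} (hn : 1 ≤ n) (p : ℕ) :
    ContFamily p fun Λ : Set.Ioc D.ΛR D.Λ0 => D.L s t n Λ := by
  refine contFamily_iff.2 ⟨fun Λ => (D.sol.smooth s t n hn Λ (Set.Ioc_subset_Icc_self Λ.2)).of_le
    (mod_cast le_top), fun j _ => ?_⟩
  exact (D.sol.continuous s t n hn j).comp_continuous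
    (by fun_prop : Continuous fun y : Set.Ioc D.ΛR D.Λ0 × MomentumSpace n => ((y.1 : ℝ), y.2))
    fun y => ⟨Set.Ioc_subset_Icc_self y.1.2, trivial⟩

variable (K N P₀ R₁ R₂) in
/-- The derivatives of order `p` of the `n`-point functions of order `(s, t)` satisfy the bound of
the theorem. -/
def HasVertexBound (s t n p : ℕ) : Prop :=
  ∃ φ, IsPln φ ∧ ∀ D : FlowData K N P₀ R₁ R₂, ∀ Λ ∈ Set.Icc D.ΛR D.Λ0,
    ∀ k ∈ momentumRegion n Λ, ‖iteratedFDeriv ℝ p (D.L s t n Λ) k‖ ≤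
      Λ ^ (4 - (n : ℤ)) * (D.ΛR ^ s)⁻¹ * (Λ ^ p)⁻¹ * φ D.ΛR Λ D.Λ0

/-- Smooth contributions to the right-hand side of the flow equation with the scaling behaviour of
the scale derivative of an `n`-point function. -/
structure IsFlowTerm (r n : ℕ) (F : FlowData K N P₀ R₁ R₂ → ℝ → MomentumSpace n → ℝ) : Prop where
  family : ∀ D p, ContFamily p fun Λ : Set.Ioc D.ΛR D.Λ0 => F D Λ
  bound : ∀ p, ∃ φ, IsPln φ ∧ ∀ D, ∀ Λ ∈ Set.Ioc D.ΛR D.Λ0, ∀ k ∈ momentumRegion n Λ,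
    ‖iteratedFDeriv ℝ p (F D Λ) k‖ ≤
      Λ ^ (3 - (n : ℤ)) * (D.ΛR ^ r)⁻¹ * (Λ ^ p)⁻¹ * φ D.ΛR Λ D.Λ0

namespace IsFlowTerm

variable {r n : ℕ} {F G : FlowData K N P₀ R₁ R₂ → ℝ → MomentumSpace n → ℝ}

theorem contDiff (hF : IsFlowTerm r n F) (D : FlowData K N P₀ R₁ R₂) {Λ : ℝ}
    (hΛ : Λ ∈ Set.Ioc D.ΛR D.Λ0) : ContDiff ℝ ∞ (F D Λ) :=
  contDiff_infty.2 fun p => (contFamily_iff.1 (hF.family D p)).1 ⟨Λ, hΛ⟩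

theorem congr (hF : IsFlowTerm r n F)
    (h : ∀ D, ∀ Λ ∈ Set.Ioc D.ΛR D.Λ0, ∀ k, G D Λ k = F D Λ k) : IsFlowTerm r n G := by
  have h' : ∀ D, ∀ Λ ∈ Set.Ioc D.ΛR D.Λ0, G D Λ = F D Λ := fun D Λ hΛ => funext (h D Λ hΛ)
  refine ⟨fun D p => ?_, fun p => ?_⟩
  · refine (congrArg _ ?_).mp (hF.family D p)
    funext Λ
    exact (h' D Λ Λ.2).symm
  · obtain ⟨φ, hφ, hb⟩ := hF.bound p
    refine ⟨φ, hφ, fun D Λ hΛ k hk => ?_⟩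
    rw [h' D Λ hΛ]
    exact hb D Λ hΛ k hk

theorem zero : IsFlowTerm (K := K) (N := N) (P₀ := P₀) (R₁ := R₁) (R₂ := R₂) r n
    fun _ _ _ => 0 := by
  refine ⟨fun D p => contFamily_zero, fun p => ⟨_, isPln_const le_rfl, fun D Λ hΛ k hk => ?_⟩⟩
  rw [iteratedFDeriv_fun_zero]
  simp

theorem add (hF : IsFlowTerm r n F) (hG : IsFlowTerm r n G) :
    IsFlowTerm r n fun D Λ k => F D Λ k + G D Λ k := by
  refine ⟨fun D p => (hF.family D p).add (hG.family D p), fun p => ?_⟩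
  obtain ⟨φ, hφ, hb⟩ := hF.bound p
  obtain ⟨ψ, hψ, hc⟩ := hG.bound p
  refine ⟨_, hφ.add hψ, fun D Λ hΛ k hk => ?_⟩
  rw [fun_iteratedFDeriv_add_apply ((hF.contDiff D hΛ).contDiffAt.of_le (mod_cast le_top))
    ((hG.contDiff D hΛ).contDiffAt.of_le (mod_cast le_top)), mul_add]
  exact (norm_add_le _ _).trans (add_le_add (hb D Λ hΛ k hk) (hc D Λ hΛ k hk))

theorem const_mul (c : ℝ) (hF : IsFlowTerm r n F) : IsFlowTerm r n fun D Λ k => c * F D Λ k := by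
  refine ⟨fun D p => (hF.family D p).const_mul c, fun p => ?_⟩
  obtain ⟨φ, hφ, hb⟩ := hF.bound p
  refine ⟨_, (isPln_const (abs_nonneg c)).mul hφ, fun D Λ hΛ k hk => ?_⟩
  have h := iteratedFDeriv_const_smul_apply (a := c)
    ((hF.contDiff D hΛ).contDiffAt.of_le (mod_cast le_top) : ContDiffAt ℝ p (F D Λ) k)
  change iteratedFDeriv ℝ p (fun k => c * F D Λ k) k = _ at h
  rw [h, norm_smul, Real.norm_eq_abs]
  refine (mul_le_mul_of_nonneg_left (hb D Λ hΛ k hk) (abs_nonneg c)).trans (le_of_eq ?_)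
  ring

theorem sum {ι : Type} (s : Finset ι) {F : ι → FlowData K N P₀ R₁ R₂ → ℝ → MomentumSpace n → ℝ}
    (h : ∀ i ∈ s, IsFlowTerm r n (F i)) : IsFlowTerm r n fun D Λ k => ∑ i ∈ s, F i D Λ k := by
  classical
  induction s using Finset.induction_on with
  | empty => simpa using zero
  | insert a s ha ih =>
    simp only [Finset.sum_insert ha]
    exact (h a (by simp)).add (ih fun i hi => h i (by simp [hi]))

end IsFlowTerm

/-- The powers of `Λ` add up to `-3 + (4 - |I| - 1) + (4 - |Iᶜ| - 1) = 3 - n`. The momentum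
restriction is inherited by both factors: the additional leg carries `∓k_I`, and the propagator
derivative vanishes unless `‖k_I‖ ≤ 2Λ`. -/
theorem isFlowTerm_branch (hK : IsCutoff K) {n s s' t t' : ℕ} (I : Finset (Fin n))
    (h1 : ∀ m p, 1 ≤ m → HasVertexBound K N P₀ R₁ R₂ s t m p)
    (h2 : ∀ m p, 1 ≤ m → HasVertexBound K N P₀ R₁ R₂ s' t' m p) :
    IsFlowTerm (K := K) (N := N) (P₀ := P₀) (R₁ := R₁) (R₂ := R₂) (s + s') n fun D Λ k =>
      propagatorDeriv K D.B Λ (∑ i ∈ I, k.1 i) * D.L s t (I.card + 1) Λ (branchMomenta k I)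
        * D.L s' t' (Iᶜ.card + 1) Λ (branchMomenta k Iᶜ) := by
  have fam1 : ∀ (D : FlowData K N P₀ R₁ R₂) p, ContFamily p fun (Λ : Set.Ioc D.ΛR D.Λ0) k =>
      propagatorDeriv K D.B Λ (channelMap I k) := fun D p => by
    simpa using (contFamily_propagatorDeriv (Λ0 := D.Λ0) hK D.pos D.abs_B_le p).comp_affine
      continuous_id (channelMap I) (c := fun _ => 0) continuous_const
  have fam2 : ∀ (D : FlowData K N P₀ R₁ R₂) (a b : ℕ) (J : Finset (Fin n)) p,
      ContFamily p fun (Λ : Set.Ioc D.ΛR D.Λ0) k => D.L a b (J.card + 1) Λ (branchMap J k) :=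
    fun D a b J p => by
      simpa using (D.contFamily a b (Nat.succ_le_succ (Nat.zero_le J.card)) p).comp_affine
        continuous_id (branchMap J) (c := fun _ => 0) continuous_const
  refine ⟨fun D p => ((fam1 D p).mul (fam2 D s t I p)).mul (fam2 D s' t' Iᶜ p), fun p => ?_⟩
  choose C hC0 hC using fun j => exists_propagatorDeriv_bound hK j
  choose φ hφ hφb using fun j => h1 (I.card + 1) j (by omega)
  choose ψ hψ hψb using fun j => h2 (Iᶜ.card + 1) j (by omega)
  have hn1 : (0 : ℝ) ≤ n + 1 := by positivity
  have hpl : ∀ i, IsPln fun ΛR Λ Λ0 => ∑ l ∈ Finset.range (i + 1), (i.choose l : ℝ) *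
      (C l * (n + 1) ^ l * (φ (i - l) ΛR Λ Λ0 * (n + 1) ^ (i - l))) := fun i =>
    IsPln.sum _ fun l _ => (isPln_const (by positivity)).mul
      ((isPln_const (mul_nonneg (hC0 l) (by positivity))).mul
        ((hφ _).mul (isPln_const (by positivity))))
  have hpl' : IsPln fun ΛR Λ Λ0 => ∑ i ∈ Finset.range (p + 1), (p.choose i : ℝ) *
      ((∑ l ∈ Finset.range (i + 1), (i.choose l : ℝ) *
        (C l * (n + 1) ^ l * (φ (i - l) ΛR Λ Λ0 * (n + 1) ^ (i - l)))) *
        (ψ (p - i) ΛR Λ Λ0 * (n + 1) ^ (p - i))) :=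
    IsPln.sum _ fun i _ => (isPln_const (by positivity)).mul
      ((hpl i).mul ((hψ _).mul (isPln_const (by positivity))))
  refine ⟨_, hpl', fun D Λ hΛ k hk => ?_⟩
  have hΛ0 : 0 < Λ := D.pos.trans hΛ.1
  have hΛI : Λ ∈ Set.Icc D.ΛR D.Λ0 := Set.Ioc_subset_Icc_self hΛ
  have hB : -Λ ^ 2 < D.B := by
    have := (abs_le.1 D.abs_B_le).1
    have h2 : D.ΛR ^ 2 < Λ ^ 2 := by
      have := D.pos
      have := hΛ.1
      gcongr
    linarith
  have hs1 : ContDiff ℝ ∞ (propagatorDeriv K D.B Λ) := contDiff_infty.2 fun p =>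
    (contFamily_iff.1 (contFamily_propagatorDeriv (Λ0 := D.Λ0) hK D.pos D.abs_B_le p)).1 ⟨Λ, hΛ⟩
  have hs2 := D.sol.smooth s t (I.card + 1) (by omega) Λ hΛI
  have hs3 := D.sol.smooth s' t' (Iᶜ.card + 1) (by omega) Λ hΛI
  -- In the opposite case the term vanishes on a whole neighbourhood of `k`, so all its derivatives
  -- vanish there.
  by_cases hkI : ‖∑ i ∈ I, k.1 i‖ ≤ 2 * Λ
  · have b1 : ∀ j ≤ p, ‖iteratedFDeriv ℝ j (fun k => propagatorDeriv K D.B Λ (channelMap I k)) k‖ ≤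
        (Λ ^ 3)⁻¹ * (Λ ^ j)⁻¹ * (C j * (n + 1) ^ j) := fun j _ => by
      refine (norm_iteratedFDeriv_comp_clm_le hs1 _ (norm_channelMap_le I) j k).trans ?_
      rw [← mul_assoc]
      exact mul_le_mul_of_nonneg_right (hC j _ _ hΛ0 hB _) (by positivity)
    have b2 : ∀ j ≤ p, ‖iteratedFDeriv ℝ j (fun k => D.L s t (I.card + 1) Λ (branchMap I k)) k‖ ≤
        (Λ ^ (4 - ((I.card + 1 : ℕ) : ℤ)) * (D.ΛR ^ s)⁻¹) * (Λ ^ j)⁻¹ *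
          (φ j D.ΛR Λ D.Λ0 * (n + 1) ^ j) := fun j _ => by
      refine (norm_iteratedFDeriv_comp_clm_le hs2 _ (norm_branchMap_le I) j k).trans ?_
      rw [← mul_assoc]
      exact mul_le_mul_of_nonneg_right
        (hφb j D Λ hΛI _ (branchMomenta_mem hΛ0.le hk hkI)) (by positivity)
    have b3 : ∀ j ≤ p, ‖iteratedFDeriv ℝ j
        (fun k => D.L s' t' (Iᶜ.card + 1) Λ (branchMap Iᶜ k)) k‖ ≤
        (Λ ^ (4 - ((Iᶜ.card + 1 : ℕ) : ℤ)) * (D.ΛR ^ s')⁻¹) * (Λ ^ j)⁻¹ *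
          (ψ j D.ΛR Λ D.Λ0 * (n + 1) ^ j) := fun j _ => by
      refine (norm_iteratedFDeriv_comp_clm_le hs3 _ (norm_branchMap_le Iᶜ) j k).trans ?_
      rw [← mul_assoc]
      exact mul_le_mul_of_nonneg_right (hψb j D Λ hΛI _
        (branchMomenta_mem hΛ0.le hk ((norm_sum_compl k I).trans_le hkI))) (by positivity)
    have c1 : ContDiff ℝ ∞ fun k => propagatorDeriv K D.B Λ (channelMap I k) :=
      hs1.comp (channelMap I).contDiff
    have c2 : ContDiff ℝ ∞ fun k => D.L s t (I.card + 1) Λ (branchMap I k) :=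
      hs2.comp (branchMap I).contDiff
    have c3 : ContDiff ℝ ∞ fun k => D.L s' t' (Iᶜ.card + 1) Λ (branchMap Iᶜ k) :=
      hs3.comp (branchMap Iᶜ).contDiff
    have b12 := fun j (hj : j ≤ p) => norm_iteratedFDeriv_mul_le_weighted c1 c2 (p := j)
      (fun i hi => b1 i (hi.trans hj)) (fun i hi => b2 i (hi.trans hj))
    refine (norm_iteratedFDeriv_mul_le_weighted (c1.mul c2) c3 b12 b3).trans (le_of_eq ?_)
    congr 2
    have hcard : I.card + Iᶜ.card = n := by
      rw [Finset.card_compl, Fintype.card_fin]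
      have := Finset.card_le_univ I
      rw [Fintype.card_fin] at this
      omega
    have hz : (Λ ^ 3)⁻¹ * Λ ^ (4 - ((I.card + 1 : ℕ) : ℤ)) * Λ ^ (4 - ((Iᶜ.card + 1 : ℕ) : ℤ)) =
        Λ ^ (3 - (n : ℤ)) := by
      rw [← zpow_natCast, ← zpow_neg, ← zpow_add₀ hΛ0.ne', ← zpow_add₀ hΛ0.ne']
      congr 1
      push_cast
      omega
    rw [← hz, pow_add, mul_inv]
    ring
  · have : (fun k : MomentumSpace n => propagatorDeriv K D.B Λ (∑ i ∈ I, k.1 i) *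
        D.L s t (I.card + 1) Λ (branchMomenta k I) *
        D.L s' t' (Iᶜ.card + 1) Λ (branchMomenta k Iᶜ)) =ᶠ[nhds k] fun _ => 0 := by
      have ho : IsOpen {y : MomentumSpace n | 2 * Λ < ‖channelMap I y‖} :=
        isOpen_lt continuous_const (channelMap I).continuous.norm
      filter_upwards [ho.mem_nhds (lt_of_not_ge hkI)] with y hy
      have h0 : propagatorDeriv K D.B Λ (∑ i ∈ I, y.1 i) = 0 :=
        propagatorDeriv_zero_high hK D.B hΛ0 (le_of_lt hy)
      rw [h0, zero_mul, zero_mul]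
    rw [(this.iteratedFDeriv ℝ p).eq_of_nhds, iteratedFDeriv_fun_zero]
    have := ((hpl'.choose_spec.choose_spec.2.2) D.ΛR Λ D.Λ0 D.pos hΛ.1.le hΛ.2).1
    have := D.pos
    simp only [Pi.zero_apply, norm_zero]
    positivity

end

section

variable {K : ℝ → ℝ} {N : ℕ → ℕ → ℕ} {P₀ : ℕ → ℕ → ℕ → ℕ → Polynomial ℝ} {R₁ R₂ : ℕ}

/-! ### The right-hand side of the flow equation -/

theorem integral_loop_eq (hK : IsCutoff K) (D : FlowData K N P₀ R₁ R₂) {Λ R : ℝ} (hΛ : 0 < Λ)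
    (hR : 2 * Λ ≤ R) (s t n : ℕ) (k : MomentumSpace n) :
    ∫ q, D.L s t (n + 2) Λ (loopMomenta k q) * propagatorDeriv K D.B Λ q =
      ∫ q in Metric.closedBall 0 R, D.L s t (n + 2) Λ (loopMap n k + loopMomenta 0 q) *
        propagatorDeriv K D.B Λ q := by
  simp_rw [← loopMomenta_eq]
  refine (setIntegral_eq_integral_of_forall_compl_eq_zero fun q hq => ?_).symm
  rw [propagatorDeriv_zero_high hK, mul_zero]
  · exact hΛ
  · have : R < ‖q‖ := by simpa using hq
    linarith

theorem contFamily_loop (hK : IsCutoff K) (D : FlowData K N P₀ R₁ R₂) (s t n p : ℕ) :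
    ContFamily p fun (x : Set.Ioc D.ΛR D.Λ0 × Momentum) (k : MomentumSpace n) =>
      D.L s t (n + 2) x.1 (loopMap n k + loopMomenta 0 x.2) * propagatorDeriv K D.B x.1 x.2 := by
  refine ContFamily.mul ((D.contFamily s t (n := n + 2) (by omega) p).comp_affine
    continuous_fst (loopMap n) ((continuous_loopMomenta_zero n).comp continuous_snd)) ?_
  -- The propagator does not depend on the external momenta: it is composed with the zero map
  -- shifted by the loop momentum.
  simpa using (contFamily_propagatorDeriv (Λ0 := D.Λ0) hK D.pos D.abs_B_le p).comp_affine
    (X' := Set.Ioc D.ΛR D.Λ0 × Momentum) continuous_fst (0 : MomentumSpace n →L[ℝ] Momentum)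
    continuous_snd

theorem isFlowTerm_loop (hK : IsCutoff K) {s t n : ℕ}
    (h : ∀ p, HasVertexBound K N P₀ R₁ R₂ s t (n + 2) p) :
    IsFlowTerm (K := K) (N := N) (P₀ := P₀) (R₁ := R₁) (R₂ := R₂) s n fun D Λ k =>
      ∫ q, D.L s t (n + 2) Λ (loopMomenta k q) * propagatorDeriv K D.B Λ q := by
  refine ⟨fun D p => ?_, fun p => ?_⟩
  · have : LocallyCompactSpace (Set.Ioc D.ΛR D.Λ0) := isLocallyClosed_Ioc.locallyCompactSpace
    -- Radius `2Λ₀` serves all scales at once, as continuity in `Λ` requires a fixed domain. The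
    -- bound below uses the sharp radius `2Λ` instead, so that the loop momenta stay in the region
    -- where the induction hypothesis holds.
    have hf := (contFamily_loop hK D s t n p).integral (μ := volume)
      (isCompact_closedBall (0 : Momentum) (2 * D.Λ0))
    refine (congrArg _ ?_).mp hf
    funext Λ k
    exact (integral_loop_eq hK D (D.pos.trans Λ.2.1)
      (mul_le_mul_of_nonneg_left Λ.2.2 zero_le_two) s t n k).symm
  · obtain ⟨φ, hφ, hb⟩ := h p
    obtain ⟨C, hC0, hC⟩ := exists_propagatorDeriv_bound hK 0
    set v : ℝ := volume.real (Metric.ball (0 : Momentum) 1) with hv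
    refine ⟨_, (isPln_const (show 0 ≤ C * (16 * v) by positivity)).mul hφ, fun D Λ hΛ k hk => ?_⟩
    have hΛ0 : 0 < Λ := D.pos.trans hΛ.1
    have hΛI : Λ ∈ Set.Icc D.ΛR D.Λ0 := Set.Ioc_subset_Icc_self hΛ
    have hB : -Λ ^ 2 < D.B := by
      have := (abs_le.1 D.abs_B_le).1
      have h2 : D.ΛR ^ 2 < Λ ^ 2 := by
        have := D.pos
        have := hΛ.1
        gcongr
      linarith
    have hs := D.sol.smooth s t (n + 2) (by omega) Λ hΛI
    have e1 : (fun k : MomentumSpace n =>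
        ∫ q, D.L s t (n + 2) Λ (loopMomenta k q) * propagatorDeriv K D.B Λ q) =
        fun k => ∫ q in Metric.closedBall 0 (2 * Λ),
          D.L s t (n + 2) Λ (loopMap n k + loopMomenta 0 q) * propagatorDeriv K D.B Λ q :=
      funext fun k => integral_loop_eq hK D hΛ0 le_rfl s t n k
    have e2 := (contFamily_loop hK D s t n p).iteratedFDeriv_integral (μ := volume)
      (isCompact_closedBall (0 : Momentum) (2 * Λ)) ⟨Λ, hΛ⟩ k
    rw [e1, e2]
    have hq : ∀ q ∈ Metric.closedBall (0 : Momentum) (2 * Λ),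
        ‖iteratedFDeriv ℝ p (fun k => D.L s t (n + 2) Λ (loopMap n k + loopMomenta 0 q) *
          propagatorDeriv K D.B Λ q) k‖ ≤ (Λ ^ 3)⁻¹ * C *
          (Λ ^ (4 - ((n + 2 : ℕ) : ℤ)) * (D.ΛR ^ s)⁻¹ * (Λ ^ p)⁻¹ * φ D.ΛR Λ D.Λ0) := by
      intro q hq
      have hq' : ‖q‖ ≤ 2 * Λ := by simpa using hq
      have hg : ContDiff ℝ ∞ fun k => D.L s t (n + 2) Λ (k + loopMomenta 0 q) :=
        hs.comp (contDiff_id.add contDiff_const)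
      have hgc : ContDiff ℝ ∞ fun k => D.L s t (n + 2) Λ (loopMap n k + loopMomenta 0 q) :=
        hg.comp (loopMap n).contDiff
      have h1 := iteratedFDeriv_const_smul_apply (a := propagatorDeriv K D.B Λ q)
        (hgc.contDiffAt.of_le (mod_cast le_top) : ContDiffAt ℝ p _ k)
      have h2 : (fun k => D.L s t (n + 2) Λ (loopMap n k + loopMomenta 0 q) *
          propagatorDeriv K D.B Λ q) = propagatorDeriv K D.B Λ q •
          fun k => D.L s t (n + 2) Λ (loopMap n k + loopMomenta 0 q) := by
        funext k; simp [mul_comm]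
      rw [h2, h1, norm_smul]
      refine mul_le_mul ?_ ?_ (norm_nonneg _) (by positivity)
      · simpa using hC D.B Λ hΛ0 hB q
      · refine (norm_iteratedFDeriv_comp_clm_le hg (loopMap n) (norm_loopMap_le n) p k).trans ?_
        rw [one_pow, mul_one, iteratedFDeriv_comp_add_right, ← loopMomenta_eq]
        exact hb D Λ hΛI _ (loopMomenta_mem hΛ0.le hk hq')
    refine (norm_setIntegral_le_of_norm_le_const
      (isCompact_closedBall (0 : Momentum) (2 * Λ)).measure_lt_top hq).trans (le_of_eq ?_)
    have hvol : volume.real (Metric.closedBall (0 : Momentum) (2 * Λ)) = 16 * v * Λ ^ 4 := by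
      rw [hv, Measure.real, Measure.addHaar_closedBall _ _ (by positivity), ENNReal.toReal_mul,
        ENNReal.toReal_ofReal (by positivity), finrank_euclideanSpace_fin, Measure.real]
      ring
    -- Power counting of the loop: propagator derivative, vertex with `n + 2` legs, four-dimensional
    -- volume.
    have hz : Λ ^ (3 - (n : ℤ)) = (Λ ^ 3)⁻¹ * Λ ^ (4 - ((n + 2 : ℕ) : ℤ)) * Λ ^ 4 := by
      rw [← zpow_natCast, ← zpow_natCast, ← zpow_neg, ← zpow_add₀ hΛ0.ne', ← zpow_add₀ hΛ0.ne']
      congr 1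
      push_cast
      ring
    rw [hvol, hz]
    ring

theorem isFlowTerm_flowRHS (hK : IsCutoff K) {r₁ r₂ n : ℕ} (hr₁ : r₁ ≤ R₁) (hr₂ : r₂ ≤ R₂)
    (hlow : ∀ s t, s ≤ R₁ → t ≤ R₂ → s + t < r₁ + r₂ → ∀ m p, 1 ≤ m →
      HasVertexBound K N P₀ R₁ R₂ s t m p)
    (hloop : ∀ p, HasVertexBound K N P₀ R₁ R₂ r₁ r₂ (n + 2) p) :
    IsFlowTerm (K := K) (N := N) (P₀ := P₀) (R₁ := R₁) (R₂ := R₂) r₁ n fun D Λ k =>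
      flowRHS K D.A D.B D.L r₁ r₂ n Λ k := by
  have hbranch : ∀ s ∈ Finset.HasAntidiagonal.antidiagonal r₁,
      ∀ t ∈ Finset.HasAntidiagonal.antidiagonal r₂, ∀ I : Finset (Fin n),
      IsFlowTerm (K := K) (N := N) (P₀ := P₀) (R₁ := R₁) (R₂ := R₂) r₁ n fun D Λ k =>
        propagatorDeriv K D.B Λ (∑ i ∈ I, k.1 i) * D.L s.1 t.1 (I.card + 1) Λ (branchMomenta k I)
        * D.L s.2 t.2 (Iᶜ.card + 1) Λ (branchMomenta k Iᶜ) := by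
    rintro ⟨s, s'⟩ hs ⟨t, t'⟩ ht I
    rw [Finset.HasAntidiagonal.mem_antidiagonal] at hs ht
    dsimp only at hs ht ⊢
    -- A factor of order zero vanishes; otherwise both factors have order strictly below `r₁ + r₂`.
    by_cases h0 : s + t = 0
    · obtain ⟨rfl, rfl⟩ : s = 0 ∧ t = 0 := by omega
      refine IsFlowTerm.zero.congr fun D Λ hΛ k => ?_
      rw [D.sol.zeroth_order _ (by omega) Λ (Set.Ioc_subset_Icc_self hΛ)]
      ring
    by_cases h0' : s' + t' = 0
    · obtain ⟨rfl, rfl⟩ : s' = 0 ∧ t' = 0 := by omega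
      refine IsFlowTerm.zero.congr fun D Λ hΛ k => ?_
      rw [D.sol.zeroth_order _ (by omega) Λ (Set.Ioc_subset_Icc_self hΛ)]
      ring
    have := isFlowTerm_branch hK I (hlow s t (by omega) (by omega) (by omega))
      (hlow s' t' (by omega) (by omega) (by omega))
    rwa [hs] at this
  have h1 := (IsFlowTerm.sum _ fun s hs => IsFlowTerm.sum _ fun t ht =>
    IsFlowTerm.sum Finset.univ fun I _ => hbranch s hs t ht I).const_mul (-(1 / 2))
  have h2 := (isFlowTerm_loop hK hloop).const_mul (-(1 / 2) * (1 / (2 * Real.pi) ^ 4))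
  refine (h1.add h2).congr fun D Λ hΛ k => ?_
  have hΛ0 : 0 < Λ := D.pos.trans hΛ.1
  rw [flowRHS, propagatorDeriv_zero_low hK D.B hΛ0 (k := 0) (by simpa using hΛ0.le)]
  ring

/-! ### Integration of the flow equation -/

theorem FlowData.continuousOn_iteratedFDeriv (D : FlowData K N P₀ R₁ R₂) (s t : ℕ) {n : ℕ}
    (hn : 1 ≤ n) (p : ℕ) (k : MomentumSpace n) :
    ContinuousOn (fun Λ => iteratedFDeriv ℝ p (D.L s t n Λ) k) (Set.Icc D.ΛR D.Λ0) :=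
  (D.sol.continuous s t n hn p).comp (f := fun Λ : ℝ => (Λ, k)) (by fun_prop)
    fun Λ hΛ => ⟨hΛ, trivial⟩

theorem iteratedFDeriv_sub_eq_integral {E : Type} [NormedAddCommGroup E] [NormedSpace ℝ E]
    [FiniteDimensional ℝ E] {S : Set ℝ} {p : ℕ} {f g : ℝ → E → ℝ}
    (hg : ContFamily p fun x : S => g x) {a b : ℝ} (hab : a ≤ b) (hS : Set.Icc a b ⊆ S)
    (hf : ∀ x ∈ Set.Icc a b, ContDiff ℝ p (f x))
    (hc : ∀ k, ContinuousOn (fun x => f x k) (Set.Icc a b))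
    (hd : ∀ k, ∀ x ∈ Set.Ioo a b, HasDerivAt (fun x => f x k) (g x k) x) (k : E) :
    iteratedFDeriv ℝ p (f b) k - iteratedFDeriv ℝ p (f a) k =
      ∫ x in Set.Icc a b, iteratedFDeriv ℝ p (g x) k := by
  obtain ⟨proj, hproj, hproj_eq⟩ : ∃ proj : ℝ → S, Continuous proj ∧
      ∀ x ∈ Set.Icc a b, (proj x : ℝ) = x :=
    ⟨fun x => ⟨Set.projIcc a b hab x, hS (Set.projIcc a b hab x).2⟩,
      (continuous_subtype_val.comp continuous_projIcc).subtype_mk _,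
      fun x hx => by simp [Set.projIcc_of_mem hab hx]⟩
  -- The projection to `[a, b]` extends the family to all scales, and the scale becomes the
  -- integration variable with a trivial parameter, as the rule for differentiating under the
  -- integral expects.
  have hG : ContFamily p fun (x : PUnit.{1} × ℝ) => g (proj x.2) :=
    hg.comp_param (φ := fun x : PUnit.{1} × ℝ => proj x.2) (hproj.comp continuous_snd)
  have hcont : ∀ k, Continuous fun x : ℝ => g (proj x) k := fun k =>
    hg.cont.comp (hproj.prodMk continuous_const)
  have h1 : ∀ k, f b k - f a k = ∫ x in Set.Icc a b, g (proj x) k := by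
    intro k
    rw [integral_Icc_eq_integral_Ioc, ← intervalIntegral.integral_of_le hab]
    refine (intervalIntegral.integral_eq_sub_of_hasDerivAt_of_le hab (f := fun x => f x k) (hc k)
      (fun x hx => ?_) ((hcont k).intervalIntegrable a b)).symm
    rw [hproj_eq x (Set.Ioo_subset_Icc_self hx)]
    exact hd k x hx
  rw [← iteratedFDeriv_sub_apply (hf b ⟨hab, le_rfl⟩).contDiffAt (hf a ⟨le_rfl, hab⟩).contDiffAt]
  have h2 : f b - f a = fun k => ∫ x in Set.Icc a b, g (proj x) k := funext h1
  rw [h2, hG.iteratedFDeriv_integral (μ := volume) isCompact_Icc PUnit.unit k]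
  refine setIntegral_congr_fun measurableSet_Icc fun x hx => ?_
  simp only [hproj_eq x hx]

theorem FlowData.iteratedFDeriv_sub_eq_integral (D : FlowData K N P₀ R₁ R₂) {s t n : ℕ}
    (hn : 1 ≤ n) (p : ℕ)
    (hF : ContFamily p fun Λ : Set.Ioc D.ΛR D.Λ0 => flowRHS K D.A D.B D.L s t n Λ)
    {a b : ℝ} (ha : D.ΛR < a) (hab : a ≤ b) (hb : b ≤ D.Λ0) (k : MomentumSpace n) :
    iteratedFDeriv ℝ p (D.L s t n b) k - iteratedFDeriv ℝ p (D.L s t n a) k =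
      ∫ Λ in Set.Icc a b, iteratedFDeriv ℝ p (flowRHS K D.A D.B D.L s t n Λ) k := by
  have hmem : Set.Icc a b ⊆ Set.Ioc D.ΛR D.Λ0 := fun Λ hΛ => ⟨ha.trans_le hΛ.1, hΛ.2.trans hb⟩
  have hmem' : Set.Icc a b ⊆ Set.Icc D.ΛR D.Λ0 := hmem.trans Set.Ioc_subset_Icc_self
  refine ScalarFlow.iteratedFDeriv_sub_eq_integral (f := fun Λ => D.L s t n Λ)
    (g := fun Λ => flowRHS K D.A D.B D.L s t n Λ) hF hab hmem
    (fun Λ hΛ => (D.sol.smooth s t n hn Λ (hmem' hΛ)).of_le (mod_cast le_top))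
    (fun k Λ hΛ => (D.sol.flow s t n hn Λ (hmem' hΛ) k).continuousWithinAt.mono hmem')
    (fun k Λ hΛ => (D.sol.flow s t n hn Λ (hmem' (Set.Ioo_subset_Icc_self hΛ)) k).hasDerivAt
      (Icc_mem_nhds (ha.trans hΛ.1) (hΛ.2.trans_le hb))) k

/-- The right-hand side of the flow is controlled only for scales above `Λ_R`, while `a = Λ_R` is
needed. The estimate is proved from `c > a` and passes to the limit, since the derivatives of the
vertex functions are continuous down to `Λ_R`. -/
theorem FlowData.norm_iteratedFDeriv_sub_le (D : FlowData K N P₀ R₁ R₂) {s t n : ℕ}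
    (hn : 1 ≤ n) (p : ℕ)
    (hF : ContFamily p fun Λ : Set.Ioc D.ΛR D.Λ0 => flowRHS K D.A D.B D.L s t n Λ)
    {a b : ℝ} (ha : D.ΛR ≤ a) (hab : a ≤ b) (hb : b ≤ D.Λ0) (k : MomentumSpace n)
    {φ ψ : ℝ → ℝ} (hφ : ∀ x ∈ Set.Icc a b, HasDerivAt φ (ψ x) x)
    (hψ : ContinuousOn ψ (Set.Icc a b))
    (hbound : ∀ x ∈ Set.Ioc a b, ‖iteratedFDeriv ℝ p (flowRHS K D.A D.B D.L s t n x) k‖ ≤ ψ x) :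
    ‖iteratedFDeriv ℝ p (D.L s t n b) k - iteratedFDeriv ℝ p (D.L s t n a) k‖ ≤ φ b - φ a := by
  rcases hab.eq_or_lt with rfl | hlt
  · simp
  have key : ∀ c ∈ Set.Ioc a b,
      ‖iteratedFDeriv ℝ p (D.L s t n b) k - iteratedFDeriv ℝ p (D.L s t n c) k‖ ≤ φ b - φ c := by
    intro c hc
    have hsub : Set.Icc c b ⊆ Set.Icc a b := Set.Icc_subset_Icc_left hc.1.le
    rw [D.iteratedFDeriv_sub_eq_integral hn p hF (ha.trans_lt hc.1) hc.2 hb k]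
    refine (norm_integral_le_of_norm_le ((hψ.mono hsub).integrableOn_compact isCompact_Icc)
      ((ae_restrict_iff' measurableSet_Icc).2 (Filter.Eventually.of_forall fun x hx =>
        hbound x ⟨hc.1.trans_le hx.1, hx.2⟩))).trans (le_of_eq ?_)
    rw [integral_Icc_eq_integral_Ioc, ← intervalIntegral.integral_of_le hc.2]
    refine intervalIntegral.integral_eq_sub_of_hasDerivAt (fun x hx => hφ x (hsub ?_)) ?_
    · rwa [Set.uIcc_of_le hc.2] at hx
    · refine ContinuousOn.intervalIntegrable ?_
      rw [Set.uIcc_of_le hc.2]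
      exact hψ.mono hsub
  have hcl : a ∈ closure (Set.Ioc a b) := by
    rw [closure_Ioc hlt.ne]; exact ⟨le_rfl, hab⟩
  have hsub : Set.Icc a b ⊆ Set.Icc D.ΛR D.Λ0 := Set.Icc_subset_Icc ha hb
  have hcL : ContinuousWithinAt (fun c => ‖iteratedFDeriv ℝ p (D.L s t n b) k -
      iteratedFDeriv ℝ p (D.L s t n c) k‖) (Set.Ioc a b) a :=
    (continuousWithinAt_const.sub ((D.continuousOn_iteratedFDeriv s t hn p k a
      (hsub ⟨le_rfl, hab⟩)).mono (Set.Ioc_subset_Icc_self.trans hsub))).norm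
  have hcR : ContinuousWithinAt (fun c => φ b - φ c) (Set.Ioc a b) a :=
    continuousWithinAt_const.sub (hφ a ⟨le_rfl, hab⟩).continuousAt.continuousWithinAt
  exact ContinuousWithinAt.closure_le hcl hcL hcR key

end

/-! ### Derivatives along the momentum directions -/

/-- Momentum conservation makes the subtracted contributions at the leg `j₀` cancel. -/
theorem eq_sum_direction {n : ℕ} (j₀ : Fin n) (k : MomentumSpace n) :
    k = ∑ x : Fin n × Fin 4, (k.1 x.1 x.2) • direction x.1 j₀ x.2 := by
  have hk : ∀ ν, ∑ i, k.1 i ν = 0 := fun ν => by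
    have := congrArg (fun v : Momentum => v ν) (mem_momentumSpace.1 k.2)
    simpa using this
  refine Subtype.ext (funext fun l => PiLp.ext fun ν => ?_)
  rw [Fintype.sum_prod_type]
  simp only [direction, AddSubmonoidClass.coe_finsetSum, SetLike.val_smul, Finset.sum_apply,
    Pi.smul_apply, Pi.sub_apply, PiLp.sub_apply, PiLp.smul_apply, smul_eq_mul, WithLp.ofLp_sum,
    mul_sub, Finset.sum_sub_distrib]
  have h1 : ∑ i : Fin n, ∑ μ : Fin 4,
      k.1 i μ * (Pi.single (M := fun _ => Momentum) i (EuclideanSpace.single μ (1 : ℝ)) l) ν =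
      k.1 l ν := by
    rw [Finset.sum_eq_single l]
    · simp
    · intro i _ hi
      simp [Pi.single_eq_of_ne hi.symm]
    · simp
  have h2 : ∑ i : Fin n, ∑ μ : Fin 4,
      k.1 i μ * (Pi.single (M := fun _ => Momentum) j₀ (EuclideanSpace.single μ (1 : ℝ)) l) ν =
      0 := by
    by_cases h : l = j₀
    · subst h
      simp [hk]
    · simp [Pi.single_eq_of_ne h]
  rw [h1, h2, sub_zero]

/-- Expanding every argument in the spanning directions gives `(4n)^p` terms, each with coefficients
bounded by the norms of the arguments. -/
theorem opNorm_le_of_directions {n p : ℕ} (hn : 1 ≤ n)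
    (M : ContinuousMultilinearMap ℝ (fun _ : Fin p => MomentumSpace n) ℝ) {C : ℝ} (hC : 0 ≤ C)
    (h : ∀ (i j : Fin p → Fin n) (μ : Fin p → Fin 4),
      |M fun a => direction (i a) (j a) (μ a)| ≤ C) : ‖M‖ ≤ (n * 4) ^ p * C := by
  refine ContinuousMultilinearMap.opNorm_le_bound (by positivity) fun v => ?_
  have e1 : M v = ∑ r : Fin p → Fin n × Fin 4,
      (∏ a, ((v a).1 (r a).1 (r a).2)) * M fun a => direction (r a).1 ⟨0, hn⟩ (r a).2 := by
    have e : v = fun a => ∑ x : Fin n × Fin 4, ((v a).1 x.1 x.2) • direction x.1 ⟨0, hn⟩ x.2 :=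
      funext fun a => eq_sum_direction _ (v a)
    conv_lhs => rw [e]
    rw [M.map_sum]
    exact Finset.sum_congr rfl fun r _ => M.map_smul_univ _ _
  rw [e1]
  refine (norm_sum_le _ _).trans ?_
  have hterm : ∀ r : Fin p → Fin n × Fin 4, ‖(∏ a, ((v a).1 (r a).1 (r a).2)) *
      M fun a => direction (r a).1 ⟨0, hn⟩ (r a).2‖ ≤ (∏ a, ‖v a‖) * C := by
    intro r
    rw [norm_mul]
    refine mul_le_mul ?_ (h _ (fun _ => ⟨0, hn⟩) _) (norm_nonneg _) (by positivity)
    rw [norm_prod]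
    exact Finset.prod_le_prod (fun _ _ => norm_nonneg _) fun a _ =>
      (PiLp.norm_apply_le _ _).trans (coe_norm_le _ _)
  refine (Finset.sum_le_sum fun r _ => hterm r).trans (le_of_eq ?_)
  simp
  ring

theorem norm_direction_le {n : ℕ} (i j : Fin n) (μ : Fin 4) :
    ‖(direction i j μ : MomentumSpace n)‖ ≤ 2 := by
  have h : ∀ i l : Fin n,
      ‖(Pi.single i (EuclideanSpace.single μ 1) : Fin n → Momentum) l‖ ≤ 1 := by
    intro i l
    by_cases hl : l = i
    · subst hl; simp
    · simp [Pi.single_eq_of_ne hl]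
  refine norm_le_of_forall_coe zero_le_two fun l => ?_
  simp only [direction, Pi.sub_apply]
  refine (norm_sub_le _ _).trans ?_
  linarith [h i l, h j l]

theorem momentumDeriv_dimensionless {L : VertexCoefficients} {s t n p : ℕ} {Λ : ℝ}
    (hL : ContDiff ℝ ∞ (L s t n Λ)) (i j : Fin p → Fin n) (μ : Fin p → Fin 4)
    (k : MomentumSpace n) :
    momentumDeriv i j μ (dimensionless L s t n Λ) k = Λ ^ ((n : ℤ) + s - 4) *
      iteratedFDeriv ℝ p (L s t n Λ) k fun a => direction (i a) (j a) (μ a) := by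
  have h := iteratedFDeriv_const_smul_apply (a := Λ ^ ((n : ℤ) + s - 4))
    (hL.contDiffAt.of_le (mod_cast le_top) : ContDiffAt ℝ p (L s t n Λ) k)
  change iteratedFDeriv ℝ p (dimensionless L s t n Λ) k = _ at h
  rw [momentumDeriv, h]
  rfl

theorem continuous_momentumDeriv_dimensionless {L : VertexCoefficients} {s t n p : ℕ} {Λ : ℝ}
    (hL : ContDiff ℝ ∞ (L s t n Λ)) (i j : Fin p → Fin n) (μ : Fin p → Fin 4) :
    Continuous (momentumDeriv i j μ (dimensionless L s t n Λ)) := by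
  have h : Continuous fun k => Λ ^ ((n : ℤ) + s - 4) *
      iteratedFDeriv ℝ p (L s t n Λ) k fun a => direction (i a) (j a) (μ a) := by
    have := hL.continuous_iteratedFDeriv (m := p) (mod_cast le_top)
    exact continuous_const.mul
      ((ContinuousMultilinearMap.apply ℝ (fun _ : Fin p => MomentumSpace n) ℝ _).continuous.comp
        this)
  exact h.congr fun k => (momentumDeriv_dimensionless hL i j μ k).symm

theorem iteratedFDeriv_zero_of_even {n p : ℕ} {f : MomentumSpace n → ℝ} (hf : ContDiff ℝ ∞ f)
    (heven : ∀ k, f (-k) = f k) (hp : Odd p) : iteratedFDeriv ℝ p f 0 = 0 := by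
  let T : MomentumSpace n →L[ℝ] MomentumSpace n := -ContinuousLinearMap.id ℝ _
  have h := T.iteratedFDeriv_comp_right (n := ∞) hf 0 (i := p) (mod_cast le_top)
  have hfT : f ∘ T = f := funext heven
  rw [hfT, map_zero] at h
  ext v
  have h1 : iteratedFDeriv ℝ p f 0 v = iteratedFDeriv ℝ p f 0 fun a => (-1 : ℝ) • v a := by
    conv_lhs => rw [h]
    exact congrArg _ (funext fun a => (neg_one_smul ℝ (v a)).symm)
  rw [ContinuousMultilinearMap.map_smul_univ, Finset.prod_const, Finset.card_univ,
    Fintype.card_fin, hp.neg_one_pow] at h1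
  simp only [smul_eq_mul] at h1
  simp only [zero_apply]
  linarith

theorem mem_momentumRegion_iff_norm_le {n : ℕ} {Λ : ℝ} (hΛ : 0 ≤ Λ) {k : MomentumSpace n} :
    k ∈ momentumRegion n Λ ↔ ‖k‖ ≤ 2 * Λ := by
  rw [mem_momentumRegion hΛ]
  exact (pi_norm_le_iff_of_nonneg (by positivity)).symm

section

variable {K : ℝ → ℝ} {N : ℕ → ℕ → ℕ} {P₀ : ℕ → ℕ → ℕ → ℕ → Polynomial ℝ} {R₁ R₂ : ℕ}

theorem hasVertexBound_of_eq_zero {s t n : ℕ} (p : ℕ)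
    (h : ∀ D : FlowData K N P₀ R₁ R₂, ∀ Λ ∈ Set.Icc D.ΛR D.Λ0, ∀ k, D.L s t n Λ k = 0) :
    HasVertexBound K N P₀ R₁ R₂ s t n p := by
  refine ⟨_, isPln_const le_rfl, fun D Λ hΛ k _ => ?_⟩
  rw [show D.L s t n Λ = fun _ => 0 from funext (h D Λ hΛ), iteratedFDeriv_fun_zero]
  simp

/-! ### Irrelevant terms -/

/-- Dividing the assumption by `Λ₀^{n + s - 4}` cancels the `Λ₀^s` of `(Λ₀ / Λ_R)^s`. -/
theorem FlowData.norm_iteratedFDeriv_initial_le (hP₀ : ∀ r₁ r₂ n p, NonnegCoeffs (P₀ r₁ r₂ n p))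
    (D : FlowData K N P₀ R₁ R₂) {s t n p : ℕ} (hs : s ≤ R₁) (ht : t ≤ R₂) (hn : 1 ≤ n)
    (hnp : 5 ≤ n + p) {k : MomentumSpace n} (hk : k ∈ momentumRegion n D.Λ0) :
    ‖iteratedFDeriv ℝ p (D.L s t n D.Λ0) k‖ ≤ (n * 4) ^ p * (D.Λ0 ^ (4 - (n : ℤ) - p) *
      (D.ΛR ^ s)⁻¹ * (P₀ s t n p).eval (Real.log (D.Λ0 / D.ΛR))) := by
  have hR := D.pos
  have h0 : 0 < D.Λ0 := hR.trans_le D.le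
  have hP := (hP₀ s t n p).eval_nonneg (log_ratio_nonneg D.pos D.le)
  have hL := D.sol.smooth s t n hn D.Λ0 ⟨D.le, le_rfl⟩
  refine opNorm_le_of_directions hn _ (by positivity) fun i j μ => ?_
  have h1 : |momentumDeriv i j μ (dimensionless D.L s t n D.Λ0) k| ≤ _ :=
    (isGreatest_vertexNorm D.Λ0 (continuous_momentumDeriv_dimensionless hL i j μ)).2 ⟨k, hk, rfl⟩
  have h2 := h1.trans (D.initial s t n p hs ht hn hnp i j μ)
  rw [momentumDeriv_dimensionless hL, abs_mul, abs_of_pos (zpow_pos h0 _)] at h2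
  have hz : 0 < D.Λ0 ^ ((n : ℤ) + s - 4) := zpow_pos h0 _
  rw [← le_div_iff₀' hz] at h2
  refine h2.trans (le_of_eq ?_)
  rw [div_eq_inv_mul, ← zpow_neg, div_pow, show (4 - (n : ℤ) - p) = -((n : ℤ) + s - 4) + (-p) + s by
    ring, zpow_add₀ h0.ne', zpow_add₀ h0.ne', zpow_natCast, zpow_neg _ (p : ℤ), zpow_natCast]
  ring

theorem hasVertexBound_irrelevant (hP₀ : ∀ r₁ r₂ n p, NonnegCoeffs (P₀ r₁ r₂ n p))
    {s t n p : ℕ} (hs : s ≤ R₁) (ht : t ≤ R₂) (hn : 1 ≤ n) (hnp : 5 ≤ n + p)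
    (hF : IsFlowTerm (K := K) (N := N) (P₀ := P₀) (R₁ := R₁) (R₂ := R₂) s n fun D Λ k =>
      flowRHS K D.A D.B D.L s t n Λ k) : HasVertexBound K N P₀ R₁ R₂ s t n p := by
  obtain ⟨χ, ⟨P, Q, hP, hQ, hχ⟩, hb⟩ := hF.bound p
  obtain ⟨P', Q', hP', hQ', hprim⟩ := exists_primitive_irrelevant hP hQ
  have hc : (0 : ℝ) ≤ (n * 4) ^ p := by positivity
  -- The first summand carries the data at `Λ₀`, which contribute only to the part suppressed by `Λ
  -- / Λ₀`; the second is the integrated flow.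
  refine ⟨_, (isPln_plnBound .zero ((NonnegCoeffs.C hc).mul (hP₀ s t n p))).add
    (isPln_plnBound hP' hQ'), fun D Λ hΛ k hk => ?_⟩
  have hR := D.pos
  have hΛ0 : 0 < Λ := hR.trans_le hΛ.1
  have h0 : 0 < D.Λ0 := hΛ0.trans_le hΛ.2
  have hRs : 0 ≤ (D.ΛR ^ s)⁻¹ := by positivity
  have he : 4 - (n : ℤ) - p ≤ -1 := by omega
  obtain ⟨φ, ψ, hφ, hψ, hle, hfin⟩ := hprim (4 - (n : ℤ) - p) he D.ΛR Λ D.Λ0 hR hΛ.1 hΛ.2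
  have hreg : ∀ x, Λ ≤ x → k ∈ momentumRegion n x := fun x hx => by
    have hx0 : 0 < x := hΛ0.trans_le hx
    rw [mem_momentumRegion_iff_norm_le hΛ0.le] at hk
    rw [mem_momentumRegion_iff_norm_le hx0.le]
    linarith
  have hsub := D.norm_iteratedFDeriv_sub_le hn p (hF.family D p) hΛ.1 hΛ.2 le_rfl k
    (φ := fun x => (D.ΛR ^ s)⁻¹ * φ x) (ψ := fun x => (D.ΛR ^ s)⁻¹ * ψ x)
    (fun x hx => (hφ x hx).const_mul _) (continuousOn_const.mul hψ) (fun x hx => by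
      have hx0 : 0 < x := hΛ0.trans hx.1
      refine (hb D x ⟨hΛ.1.trans_lt hx.1, hx.2⟩ k (hreg x hx.1.le)).trans ?_
      have h2 := hle x ⟨hx.1.le, hx.2⟩
      have h3 := (hχ D.ΛR x D.Λ0 hR (hΛ.1.trans hx.1.le) hx.2).2
      have hz : x ^ (4 - (n : ℤ) - p - 1) = x ^ (3 - (n : ℤ)) * (x ^ p)⁻¹ := by
        rw [show 4 - (n : ℤ) - p - 1 = (3 - n) + (-p) by ring, zpow_add₀ hx0.ne', zpow_neg,
          zpow_natCast]
      calc _ = (D.ΛR ^ s)⁻¹ * (x ^ (4 - (n : ℤ) - p - 1) * χ D.ΛR x D.Λ0) := by rw [hz]; ring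
        _ ≤ (D.ΛR ^ s)⁻¹ * (x ^ (4 - (n : ℤ) - p - 1) * plnBound P Q D.ΛR x D.Λ0) := by gcongr
        _ ≤ _ := by gcongr)
  have hini := D.norm_iteratedFDeriv_initial_le hP₀ hs ht hn hnp (hreg D.Λ0 hΛ.2)
  have hPn := (hP₀ s t n p).eval_nonneg (log_ratio_nonneg D.pos D.le)
  have hz1 : Λ ^ (4 - (n : ℤ)) * (D.ΛR ^ s)⁻¹ * (Λ ^ p)⁻¹ =
      Λ ^ (4 - (n : ℤ) - p) * (D.ΛR ^ s)⁻¹ := by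
    rw [mul_right_comm, show 4 - (n : ℤ) - p = (4 - n) + (-p) by ring, zpow_add₀ hΛ0.ne', zpow_neg, zpow_natCast]
  -- The exponent is at most `-1`, so one power of `Λ / Λ₀` can be split off. This is the source of
  -- the suppression of the initial data.
  have hz2 : D.Λ0 ^ (4 - (n : ℤ) - p) ≤ Λ ^ (4 - (n : ℤ) - p) * (Λ / D.Λ0) := by
    obtain ⟨m, hm⟩ : ∃ m : ℕ, 4 - (n : ℤ) - p = -(m + 1 : ℕ) := ⟨n + p - 5, by omega⟩
    rw [hm, zpow_neg, zpow_neg, zpow_natCast, zpow_natCast, pow_succ, pow_succ]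
    have h3 : (D.Λ0 ^ m)⁻¹ ≤ (Λ ^ m)⁻¹ := by
      have := hΛ.2
      gcongr
    calc (D.Λ0 ^ m * D.Λ0)⁻¹ = (D.Λ0 ^ m)⁻¹ * D.Λ0⁻¹ := by rw [mul_inv]
      _ ≤ (Λ ^ m)⁻¹ * D.Λ0⁻¹ := by gcongr
      _ = (Λ ^ m * Λ)⁻¹ * (Λ / D.Λ0) := by field_simp
  have hini' : ‖iteratedFDeriv ℝ p (D.L s t n D.Λ0) k‖ ≤ (n * 4) ^ p *
      (Λ ^ (4 - (n : ℤ) - p) * (Λ / D.Λ0) * (D.ΛR ^ s)⁻¹ *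
        (P₀ s t n p).eval (Real.log (D.Λ0 / D.ΛR))) := hini.trans (by gcongr)
  have htri : ‖iteratedFDeriv ℝ p (D.L s t n Λ) k‖ ≤ ‖iteratedFDeriv ℝ p (D.L s t n D.Λ0) k‖ +
      ‖iteratedFDeriv ℝ p (D.L s t n D.Λ0) k - iteratedFDeriv ℝ p (D.L s t n Λ) k‖ :=
    norm_le_insert _ _
  have hfin' : (D.ΛR ^ s)⁻¹ * φ D.Λ0 - (D.ΛR ^ s)⁻¹ * φ Λ ≤
      (D.ΛR ^ s)⁻¹ * (Λ ^ (4 - (n : ℤ) - p) * plnBound P' Q' D.ΛR Λ D.Λ0) := by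
    rw [← mul_sub]; gcongr
  refine htri.trans ((add_le_add hini' (hsub.trans hfin')).trans (le_of_eq ?_))
  rw [hz1]
  simp only [plnBound, Polynomial.eval_zero, Polynomial.eval_mul, Polynomial.eval_C]
  ring

/-! ### Relevant and marginal terms -/

variable (K N P₀ R₁ R₂) in
/-- The bound of `HasVertexBound` at zero momenta. -/
def HasVertexBoundAtZero (s t n p : ℕ) : Prop :=
  ∃ φ, IsPln φ ∧ ∀ D : FlowData K N P₀ R₁ R₂, ∀ Λ ∈ Set.Icc D.ΛR D.Λ0,
    ‖iteratedFDeriv ℝ p (D.L s t n Λ) 0‖ ≤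
      Λ ^ (4 - (n : ℤ)) * (D.ΛR ^ s)⁻¹ * (Λ ^ p)⁻¹ * φ D.ΛR Λ D.Λ0

/-- The reflection `k ↦ -k` belongs to the orthogonal group, so the vertex functions are even. -/
theorem hasVertexBoundAtZero_of_odd {s t n p : ℕ} (hn : 1 ≤ n) (hp : Odd p) :
    HasVertexBoundAtZero K N P₀ R₁ R₂ s t n p := by
  refine ⟨_, isPln_const le_rfl, fun D Λ hΛ => ?_⟩
  rw [iteratedFDeriv_zero_of_even (D.sol.smooth s t n hn Λ hΛ) (fun k => ?_) hp]
  · simp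
  · exact D.sol.orthogonal s t n hn Λ hΛ (LinearIsometryEquiv.neg ℝ) k

theorem hasVertexBoundAtZero_relevant {s t n p : ℕ} (hn : 1 ≤ n) (hnp : n + p ≤ 4)
    (hinit : ∀ D : FlowData K N P₀ R₁ R₂, ‖iteratedFDeriv ℝ p (D.L s t n D.ΛR) 0‖ ≤
      D.ΛR ^ (4 - (n : ℤ) - p) * (D.ΛR ^ s)⁻¹)
    (hF : IsFlowTerm (K := K) (N := N) (P₀ := P₀) (R₁ := R₁) (R₂ := R₂) s n fun D Λ k =>
      flowRHS K D.A D.B D.L s t n Λ k) : HasVertexBoundAtZero K N P₀ R₁ R₂ s t n p := by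
  obtain ⟨χ, ⟨P, Q, hP, hQ, hχ⟩, hb⟩ := hF.bound p
  obtain ⟨P', Q', hP', hQ', hprim⟩ := exists_primitive_relevant hP hQ
  refine ⟨_, (isPln_const zero_le_one).add (isPln_plnBound hP' hQ'), fun D Λ hΛ => ?_⟩
  have hR := D.pos
  have hΛ0 : 0 < Λ := hR.trans_le hΛ.1
  have hRs : 0 ≤ (D.ΛR ^ s)⁻¹ := by positivity
  have he : 0 ≤ 4 - (n : ℤ) - p := by omega
  obtain ⟨φ, ψ, hφ, hψ, hle, hfin⟩ := hprim (4 - (n : ℤ) - p) he D.ΛR Λ D.Λ0 hR hΛ.1 hΛ.2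
  have hsub := D.norm_iteratedFDeriv_sub_le hn p (hF.family D p) le_rfl hΛ.1 hΛ.2 0
    (φ := fun x => (D.ΛR ^ s)⁻¹ * φ x) (ψ := fun x => (D.ΛR ^ s)⁻¹ * ψ x)
    (fun x hx => (hφ x hx).const_mul _) (continuousOn_const.mul hψ) (fun x hx => by
      have hx0 : 0 < x := hR.trans hx.1
      have hreg : (0 : MomentumSpace n) ∈ momentumRegion n x := by
        rw [mem_momentumRegion_iff_norm_le hx0.le]; simp [hx0.le]
      refine (hb D x ⟨hx.1, hx.2.trans hΛ.2⟩ 0 hreg).trans ?_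
      have h2 := hle x ⟨hx.1.le, hx.2⟩
      have h3 := (hχ D.ΛR x D.Λ0 hR hx.1.le (hx.2.trans hΛ.2)).2
      have hz : x ^ (4 - (n : ℤ) - p - 1) = x ^ (3 - (n : ℤ)) * (x ^ p)⁻¹ := by
        rw [show 4 - (n : ℤ) - p - 1 = (3 - n) + (-p) by ring, zpow_add₀ hx0.ne', zpow_neg,
          zpow_natCast]
      calc _ = (D.ΛR ^ s)⁻¹ * (x ^ (4 - (n : ℤ) - p - 1) * χ D.ΛR x D.Λ0) := by rw [hz]; ring
        _ ≤ (D.ΛR ^ s)⁻¹ * (x ^ (4 - (n : ℤ) - p - 1) * plnBound P Q D.ΛR x D.Λ0) := by gcongr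
        _ ≤ _ := by gcongr)
  have hz1 : Λ ^ (4 - (n : ℤ)) * (D.ΛR ^ s)⁻¹ * (Λ ^ p)⁻¹ =
      Λ ^ (4 - (n : ℤ) - p) * (D.ΛR ^ s)⁻¹ := by
    rw [mul_right_comm, show 4 - (n : ℤ) - p = (4 - n) + (-p) by ring, zpow_add₀ hΛ0.ne', zpow_neg, zpow_natCast]
  have hz2 : D.ΛR ^ (4 - (n : ℤ) - p) ≤ Λ ^ (4 - (n : ℤ) - p) := by
    obtain ⟨m, hm⟩ := Int.eq_ofNat_of_zero_le he
    have := hΛ.1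
    rw [hm, zpow_natCast, zpow_natCast]
    gcongr
  have hini : ‖iteratedFDeriv ℝ p (D.L s t n D.ΛR) 0‖ ≤
      Λ ^ (4 - (n : ℤ) - p) * (D.ΛR ^ s)⁻¹ := (hinit D).trans (by gcongr)
  have htri : ‖iteratedFDeriv ℝ p (D.L s t n Λ) 0‖ ≤ ‖iteratedFDeriv ℝ p (D.L s t n D.ΛR) 0‖ +
      ‖iteratedFDeriv ℝ p (D.L s t n Λ) 0 - iteratedFDeriv ℝ p (D.L s t n D.ΛR) 0‖ :=
    norm_le_insert' _ _
  have hfin' : (D.ΛR ^ s)⁻¹ * φ Λ - (D.ΛR ^ s)⁻¹ * φ D.ΛR ≤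
      (D.ΛR ^ s)⁻¹ * (Λ ^ (4 - (n : ℤ) - p) * plnBound P' Q' D.ΛR Λ D.Λ0) := by
    rw [← mul_sub]; gcongr
  refine htri.trans ((add_le_add hini (hsub.trans hfin')).trans (le_of_eq ?_))
  rw [hz1]
  ring

/-- The momentum region is the ball of radius `2Λ` in the sup norm. The mean value inequality there
costs `2Λ`, which turns `Λ^{-(p+1)}` into `2Λ⁻ᵖ`. -/
theorem hasVertexBound_of_atZero {s t n p : ℕ} (hn : 1 ≤ n)
    (h0 : HasVertexBoundAtZero K N P₀ R₁ R₂ s t n p)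
    (h1 : HasVertexBound K N P₀ R₁ R₂ s t n (p + 1)) : HasVertexBound K N P₀ R₁ R₂ s t n p := by
  obtain ⟨φ, hφ, hb⟩ := h0
  obtain ⟨χ, hχ, hc⟩ := h1
  refine ⟨_, hφ.add ((isPln_const zero_le_two).mul hχ), fun D Λ hΛ k hk => ?_⟩
  have hR := D.pos
  have hΛ0 : 0 < Λ := hR.trans_le hΛ.1
  have hL := D.sol.smooth s t n hn Λ hΛ
  have hχ0 := (hχ.choose_spec.choose_spec.2.2 D.ΛR Λ D.Λ0 hR hΛ.1 hΛ.2).1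
  rw [mem_momentumRegion_iff_norm_le hΛ0.le] at hk
  have hmv := Convex.norm_image_sub_le_of_norm_fderiv_le (𝕜 := ℝ)
    (f := iteratedFDeriv ℝ p (D.L s t n Λ)) (s := Metric.closedBall (0 : MomentumSpace n) (2 * Λ))
    (x := 0) (y := k)
    (C := Λ ^ (4 - (n : ℤ)) * (D.ΛR ^ s)⁻¹ * (Λ ^ (p + 1))⁻¹ * χ D.ΛR Λ D.Λ0)
    (fun x _ => (hL.differentiable_iteratedFDeriv (m := p) (mod_cast WithTop.coe_lt_top _)) x)
    (fun x hx => by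
      rw [norm_fderiv_iteratedFDeriv]
      refine hc D Λ hΛ x ?_
      rw [mem_momentumRegion_iff_norm_le hΛ0.le]
      simpa using hx)
    (convex_closedBall _ _) (by simp [hΛ0.le]) (by simpa using hk)
  rw [sub_zero] at hmv
  have hmv' := hmv.trans (mul_le_mul_of_nonneg_left hk (by positivity))
  refine (norm_le_insert' _ _).trans ((add_le_add (hb D Λ hΛ) hmv').trans (le_of_eq ?_))
  rw [pow_succ, mul_inv]
  field_simp

/-! ### The renormalization conditions -/

/-- With two legs every direction is `0` or `±1` times that of `∂^μ_{1,2}`, so the condition on `ρ₃`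
fixes the whole second derivative. -/
theorem iteratedFDeriv_two_zero (D : FlowData K N P₀ R₁ R₂) (s t : ℕ) :
    iteratedFDeriv ℝ 2 (D.L s t 2 D.ΛR) 0 = 0 := by
  set M := iteratedFDeriv ℝ 2 (D.L s t 2 D.ΛR) 0 with hM
  have hdir : ∀ (i j : Fin 2) (μ : Fin 4), ∃ ε : ℝ, (direction i j μ : MomentumSpace 2) =
      ε • direction 0 1 μ := by
    intro i j μ
    fin_cases i <;> fin_cases j
    · exact ⟨0, Subtype.ext (by simp [direction])⟩
    · exact ⟨1, by simp⟩
    · exact ⟨-1, Subtype.ext (by simp [direction])⟩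
    · exact ⟨0, Subtype.ext (by simp [direction])⟩
  choose ε hε using hdir
  have h := opNorm_le_of_directions (by norm_num) M le_rfl fun i j μ => by
    rw [show (fun a => direction (i a) (j a) (μ a)) =
      fun a => ε (i a) (j a) (μ a) • (direction 0 1 (μ a) : MomentumSpace 2) from
        funext fun a => hε _ _ _]
    rw [M.map_smul_univ (fun a => ε (i a) (j a) (μ a)) fun a => direction 0 1 (μ a)]
    have h3 : momentumDeriv ![0, 0] ![1, 1] ![μ 0, μ 1] (D.L s t 2 D.ΛR) 0 = 0 :=
      D.ren.rho_three s t (μ 0) (μ 1)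
    have h4 : (fun a : Fin 2 => (direction (![0, 0] a) (![1, 1] a) (![μ 0, μ 1] a) :
        MomentumSpace 2)) = fun a => direction 0 1 (μ a) := by
      funext a
      fin_cases a <;> rfl
    rw [momentumDeriv, h4, ← hM] at h3
    rw [h3, smul_zero, abs_zero]
  rw [mul_zero] at h
  exact norm_le_zero_iff.1 h

/-- Only two values are nonzero, and both saturate the bound: `ρ₄` at order `(1, 0)` gives `Λ_R ·
Λ_R⁻¹ = 1`, and `ρ₅` at order `(0, 1)` gives `Λ_R⁰ = 1`. For `n = 1`, `p = 2` the momentum space is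
trivial. -/
theorem norm_iteratedFDeriv_renormalization_le (D : FlowData K N P₀ R₁ R₂) {s t n p : ℕ}
    (hn : 1 ≤ n) (hnp : n + p ≤ 4) (hp : Even p) :
    ‖iteratedFDeriv ℝ p (D.L s t n D.ΛR) 0‖ ≤ D.ΛR ^ (4 - (n : ℤ) - p) * (D.ΛR ^ s)⁻¹ := by
  have hR := D.pos
  obtain ⟨q, rfl⟩ := hp
  have hq : q = 0 ∨ q = 1 := by omega
  rcases hq with rfl | rfl
  · rw [add_zero, norm_iteratedFDeriv_zero]
    have h4 : n = 1 ∨ n = 2 ∨ n = 3 ∨ n = 4 := by omega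
    rcases h4 with rfl | rfl | rfl | rfl
    · rw [D.ren.rho_one, norm_zero]; positivity
    · rw [D.ren.rho_two, norm_zero]; positivity
    · rw [D.ren.rho_four]
      split_ifs with h
      · rw [h.1]
        norm_num
        rw [mul_inv_cancel₀ hR.ne']
      · rw [norm_zero]; positivity
    · rw [D.ren.rho_five]
      split_ifs with h
      · rw [h.1]; norm_num
      · rw [norm_zero]; positivity
  · have h2 : n = 1 ∨ n = 2 := by omega
    rcases h2 with rfl | rfl
    · have h := opNorm_le_of_directions le_rfl (iteratedFDeriv ℝ (1 + 1) (D.L s t 1 D.ΛR) 0) le_rfl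
        fun i j μ => by
          have h0 : (fun a => direction (i a) (j a) (μ a)) =
              (0 : Fin (1 + 1) → MomentumSpace 1) := by
            funext a
            rw [Subsingleton.elim (i a) (j a)]
            exact Subtype.ext (by simp [direction])
          rw [h0, ContinuousMultilinearMap.map_zero, abs_zero]
      rw [mul_zero] at h
      exact h.trans (by positivity)
    · rw [show 1 + 1 = 2 from rfl, iteratedFDeriv_two_zero, norm_zero]
      positivity

/-! ### Induction -/

theorem hasVertexBound_of_isFlowTerm (hP₀ : ∀ r₁ r₂ n p, NonnegCoeffs (P₀ r₁ r₂ n p))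
    {s t n : ℕ} (hs : s ≤ R₁) (ht : t ≤ R₂) (hn : 1 ≤ n)
    (hF : IsFlowTerm (K := K) (N := N) (P₀ := P₀) (R₁ := R₁) (R₂ := R₂) s n fun D Λ k =>
      flowRHS K D.A D.B D.L s t n Λ k) (p : ℕ) : HasVertexBound K N P₀ R₁ R₂ s t n p := by
  -- The number `d` counts the derivatives still missing to reach the irrelevant range, so induction
  -- on `d` descends in `p`.
  have key : ∀ d p, 5 ≤ n + p + d → HasVertexBound K N P₀ R₁ R₂ s t n p := by
    intro d
    induction d with
    | zero => exact fun p hp => hasVertexBound_irrelevant hP₀ hs ht hn hp hF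
    | succ d ih =>
      intro p hp
      by_cases h : 5 ≤ n + p
      · exact hasVertexBound_irrelevant hP₀ hs ht hn h hF
      refine hasVertexBound_of_atZero hn ?_ (ih (p + 1) (by omega))
      rcases Nat.even_or_odd p with he | ho
      · exact hasVertexBoundAtZero_relevant hn (by omega)
          (fun D => norm_iteratedFDeriv_renormalization_le D hn (by omega) he) hF
      · exact hasVertexBoundAtZero_of_odd hn ho
  exact key 5 p (by omega)

theorem hasVertexBound (hK : IsCutoff K) (hP₀ : ∀ r₁ r₂ n p, NonnegCoeffs (P₀ r₁ r₂ n p)) :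
    ∀ (d s t : ℕ), s + t < d → s ≤ R₁ → t ≤ R₂ → ∀ n p, 1 ≤ n →
      HasVertexBound K N P₀ R₁ R₂ s t n p := by
  intro d
  induction d with
  | zero => intro s t h; omega
  | succ d ih =>
    intro s t hst hs ht
    -- Descent in `n`, started above the field degree, where the vertex functions vanish; the loop
    -- term needs only `n + 2`.
    have key : ∀ e n, N s t < n + e → 1 ≤ n → ∀ p, HasVertexBound K N P₀ R₁ R₂ s t n p := by
      intro e
      induction e with
      | zero =>
        exact fun n hN hn p => hasVertexBound_of_eq_zero p fun D => D.sol.degree s t n hn hN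
      | succ e ihe =>
        intro n hN hn
        exact hasVertexBound_of_isFlowTerm hP₀ hs ht hn (isFlowTerm_flowRHS hK hs ht
          (fun s' t' hs' ht' hlt m p hm => ih s' t' (by omega) hs' ht' m p hm)
          (ihe (n + 2) (by omega) (by omega)))
    exact fun n p hn => key (N s t + 1) n (by omega) hn p

/-! ### From operator norms back to the norms of the theorem -/

theorem exists_polynomials_vertexNorm_le {s t n p : ℕ} (hn : 1 ≤ n)
    (h : HasVertexBound K N P₀ R₁ R₂ s t n p) :
    ∃ P Q : Polynomial ℝ, NonnegCoeffs P ∧ NonnegCoeffs Q ∧ ∀ D : FlowData K N P₀ R₁ R₂,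
      ∀ Λ ∈ Set.Icc D.ΛR D.Λ0, ∀ (i j : Fin p → Fin n) (μ : Fin p → Fin 4),
        vertexNorm Λ (momentumDeriv i j μ (dimensionless D.L s t n Λ)) ≤
          (Λ ^ p)⁻¹ * (Λ / D.ΛR) ^ s * (P.eval (Real.log (Λ / D.ΛR)) +
            Λ / D.Λ0 * Q.eval (Real.log (D.Λ0 / D.ΛR))) := by
  obtain ⟨φ, hφ, hb⟩ := h
  -- The factor `2 ^ p` accounts for the `p` directions, each of norm at most `2`.
  obtain ⟨P, Q, hP, hQ, hφb⟩ := hφ.mul (isPln_const (show (0 : ℝ) ≤ 2 ^ p by positivity))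
  refine ⟨P, Q, hP, hQ, fun D Λ hΛ i j μ => ?_⟩
  have hR := D.pos
  have hΛ0 : 0 < Λ := hR.trans_le hΛ.1
  have hL := D.sol.smooth s t n hn Λ hΛ
  obtain ⟨k, hk, hkeq⟩ :=
    (isGreatest_vertexNorm Λ (continuous_momentumDeriv_dimensionless hL i j μ)).1
  rw [← hkeq]
  simp only
  rw [momentumDeriv_dimensionless hL, abs_mul, abs_of_pos (zpow_pos hΛ0 _)]
  have h1 : |iteratedFDeriv ℝ p (D.L s t n Λ) k fun a => direction (i a) (j a) (μ a)| ≤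
      ‖iteratedFDeriv ℝ p (D.L s t n Λ) k‖ * 2 ^ p := by
    refine ((iteratedFDeriv ℝ p (D.L s t n Λ) k).le_opNorm _).trans ?_
    refine mul_le_mul_of_nonneg_left ?_ (norm_nonneg _)
    calc ∏ a, ‖(direction (i a) (j a) (μ a) : MomentumSpace n)‖ ≤ ∏ _a : Fin p, (2 : ℝ) :=
          Finset.prod_le_prod (fun _ _ => norm_nonneg _) fun a _ => norm_direction_le _ _ _
      _ = 2 ^ p := by simp
  have h2 := (hφb D.ΛR Λ D.Λ0 hR hΛ.1 hΛ.2).2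
  have hz : Λ ^ ((n : ℤ) + s - 4) * Λ ^ (4 - (n : ℤ)) = Λ ^ s := by
    rw [← zpow_add₀ hΛ0.ne', ← zpow_natCast]
    congr 1
    ring
  calc _ ≤ Λ ^ ((n : ℤ) + s - 4) * ((Λ ^ (4 - (n : ℤ)) * (D.ΛR ^ s)⁻¹ * (Λ ^ p)⁻¹ *
        φ D.ΛR Λ D.Λ0) * 2 ^ p) := by
        refine mul_le_mul_of_nonneg_left (h1.trans ?_) (zpow_pos hΛ0 _).le
        exact mul_le_mul_of_nonneg_right (hb D Λ hΛ k hk) (by positivity)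
    _ = (Λ ^ p)⁻¹ * (Λ / D.ΛR) ^ s * (φ D.ΛR Λ D.Λ0 * 2 ^ p) := by
        rw [div_pow, ← hz]; ring
    _ ≤ _ := mul_le_mul_of_nonneg_left h2 (by positivity)

end

end ScalarFlow

theorem mainTheorem4 (K : ℝ → ℝ) (hK : ScalarFlow.IsCutoff K) (N : ℕ → ℕ → ℕ)
    (P₀ : ℕ → ℕ → ℕ → ℕ → Polynomial ℝ) (hP₀ : ∀ r₁ r₂ n p i, 0 ≤ (P₀ r₁ r₂ n p).coeff i)
    (r₁ r₂ n p : ℕ) (hn : 1 ≤ n) :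
    ∃ P Q : Polynomial ℝ, (∀ i, 0 ≤ P.coeff i) ∧ (∀ i, 0 ≤ Q.coeff i) ∧
      ∀ (ΛR Λ0 A B : ℝ), 0 < ΛR → ΛR ≤ Λ0 → |A| ≤ ΛR ^ 3 → |B| ≤ ΛR ^ 2 →
      ∀ L : ScalarFlow.VertexCoefficients,
        ScalarFlow.IsPerturbativeSolution K A B N ΛR Λ0 L →
        ScalarFlow.RenormalizationConditions ΛR L →
        (∀ s₁ s₂ m q : ℕ, s₁ ≤ r₁ → s₂ ≤ r₂ → 1 ≤ m → 5 ≤ m + q →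
          ∀ (i j : Fin q → Fin m) (μ : Fin q → Fin 4),
            ScalarFlow.vertexNorm Λ0 (ScalarFlow.momentumDeriv i j μ
                (ScalarFlow.dimensionless L s₁ s₂ m Λ0))
              ≤ (Λ0 ^ q)⁻¹ * (Λ0 / ΛR) ^ s₁
                * (P₀ s₁ s₂ m q).eval (Real.log (Λ0 / ΛR))) →
        ∀ Λ ∈ Set.Icc ΛR Λ0, ∀ (i j : Fin p → Fin n) (μ : Fin p → Fin 4),
          ScalarFlow.vertexNorm Λ (ScalarFlow.momentumDeriv i j μ
              (ScalarFlow.dimensionless L r₁ r₂ n Λ))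
            ≤ (Λ ^ p)⁻¹ * (Λ / ΛR) ^ r₁
              * (P.eval (Real.log (Λ / ΛR))
                  + Λ / Λ0 * Q.eval (Real.log (Λ0 / ΛR))) := by
  obtain ⟨P, Q, hP, hQ, h⟩ := ScalarFlow.exists_polynomials_vertexNorm_le hn
    (ScalarFlow.hasVertexBound (K := K) (N := N) (P₀ := P₀) (R₁ := r₁) (R₂ := r₂) hK hP₀
      (r₁ + r₂ + 1) r₁ r₂ (by omega) le_rfl le_rfl n p hn)
  refine ⟨P, Q, hP, hQ, fun ΛR Λ0 A B hR hle _ hB L hsol hren hinit => ?_⟩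
  exact h ⟨ΛR, Λ0, A, B, L, hR, hle, hB, hsol, hren, hinit⟩
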